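/- Let $d\ge 1$, $\mathcal X=[0,1]^d$, let $\mu:\mathcal X\to\mathbb R$ be measurable, and let a simulation run at $x\in\mathcal X$ return $Y(x)=\mu(x)+\epsilon(x)$, with noise independent between runs. Assume: (A1) $\mathbb E\,\epsilon(x)=0$ and $\mathbb E\,e^{\lambda\epsilon(x)}\le e^{\lambda^2C_{\rm sg}^2/2}$ for all $x\in\mathcal X$, $\lambda\in\mathbb R$; (A2) $\mu$ has a unique maximizer $x^*$ on $\mathcal X$, and there is $C>0$ with $\mu(x^*)-\mu(x)\le C\|x-x^*\|$ for all $x\in\mathcal X$ (Euclidean norm); (A3) for every $\varepsilon>0$ there is $\delta>0$ with $\mu(x)<\mu(x^*)-\delta$ for all $x\in\mathcal X$ with $\|x-x^*\|\ge\varepsilon$. Let $\alpha\in(0,\frac12]$, $\kappa\in(0,1]$, $\beta\in(0,\frac12)$, let $f:\mathbb N\to(0,\infty)$ be nondecreasing, and let $N_0\in\mathbb N$. *Regular Tree Search* keeps a binary tree of subrectangles of $\mathcal X$ with root $\mathcal X$ (depth $0$), and two disjoint sets of samples (pairs of a point and its response), the $\mathcal I$-samples and the $\mathcal J$-samples. *Splitting.*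 For a leaf $L$ with sides $[r_j^-,r_j^+]$ and depth $c$, a split at $x^{(j)}=z$ into $\{x\in L:x^{(j)}\le z\}$ and $\{x\in L:x^{(j)}>z\}$ is admissible if $(1-\alpha)r_j^-+\alpha r_j^+\le z\le\alpha r_j^-+(1-\alpha)r_j^+$ and both parts contain at least $\beta f(c)$ $\mathcal I$-samples. For each node, independently of everything else, with probability $\kappa$ the direction $j$ is fixed to be uniformly random, and otherwise it is free. Among the admissible splits (with that direction, if it is fixed), one is taken that minimizes the sum over the two parts of the squared deviations of the responses of the $\mathcal J$-samples in the part from their mean. Ties are broken by any measurable rule that sees only the depth and the rectangle, the random direction choice, the positions of the $\mathcal I$-samples of $L$ and the $\mathcal J$-samples of $L$. If no split is admissible, $L$ stays a leaf for the time being. *Stage 1.* Draw $N_0$ independent uniform points of $\mathcal X$ and simulate once at each; $\lfloor N_0/2\rfloor$ of the samples are $\mathcal I$-samples, the others are $\mathcal J$-samples. Split leaves of depth $c$ with at least $f(c)$ $\mathcal I$-samples as long as this is possible. *Stage 2.* As long as fewer than $N$ simulations have been run: a tree search strategy selects a leaf $\hat L$, of depth $c$ say; a uniform point of $\hat L$ is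 drawn and simulated, and the result is added to the $\mathcal I$-samples. If $\hat L$ now contains at least $f(c)$ $\mathcal I$-samples, simulate at fresh uniform points of $\hat L$ until it contains at least $f(c)$ $\mathcal J$-samples, and split it. The strategy is any rule that selects a leaf from the current state and the earlier ones, possibly with a random seed; neither it nor $N_0$ depends on $N$. *Output.* For a leaf $L$, let $\bar Y_L$ be the mean of the responses of the $\mathcal I$-samples in $L$. When the search with budget $N$ stops, it returns a leaf $L_N^*$ that maximizes $\bar Y_L$ over all current leaves $L$. **Theorem.** Assume (A1)–(A3), and suppose that there are $h^-,h^+:\mathbb N\to\mathbb N$ such that - with probability tending to $1$ as $N\to\infty$ (for example, surely), every leaf of the tree obtained with budget $N$ has depth between $h^-(N)$ and $h^+(N)$; - $\lim_{N\to\infty}h^-(N)=\infty$; - $\lim_{N\to\infty}h^+(N)/f(h^-(N))=0$. Then $\bar Y_{L_N^*}\to\mu(x^*)$ in probability as $N\to\infty$. -/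

import Mathlib

open MeasureTheory ProbabilityTheory Filter Topology
open scoped ENNReal NNReal

namespace RegularTreeSearch

noncomputable section

/-- Design points: `ℝ^d` with the Euclidean norm. -/
abbrev Point (d : ℕ) : Type := EuclideanSpace ℝ (Fin d)

/-- The feasible domain `[0, 1]^d`. -/
def cube (d : ℕ) : Set (Point d) := {x | ∀ j, x j ∈ Set.Icc (0 : ℝ) 1}

/-- The parameters of the algorithm: spatial balance `α`, random split `κ`, sample balance
`β` and the sample threshold `f`, a function of the depth. -/
structure Params where
  α : ℝ
  κ : ℝ
  β : ℝ
  f : ℕ → ℝ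

/-- The admissible ranges of the parameters; the threshold is positive and nondecreasing in
the depth. -/
structure Params.Valid (p : Params) : Prop where
  α_pos : 0 < p.α
  α_le : p.α ≤ 1 / 2
  κ_pos : 0 < p.κ
  κ_le : p.κ ≤ 1
  β_pos : 0 < p.β
  β_lt : p.β < 1 / 2
  f_pos : ∀ c, 0 < p.f c
  f_mono : Monotone p.f

/-! ### The splitting criterion -/

/-- The average of a list of reals (`0` for the empty list). -/
def average (l : List ℝ) : ℝ := l.sum / l.length

/-- The sum of the squared deviations of the responses from their average. -/
def squaredError {d : ℕ} (D : List (Point d × ℝ)) : ℝ :=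
  (D.map fun s => (s.2 - average (D.map Prod.snd)) ^ 2).sum

/-- The part of a data set that lies in `{x | x j ≤ z}`. -/
def lower {d : ℕ} (j : Fin d) (z : ℝ) (D : List (Point d × ℝ)) : List (Point d × ℝ) :=
  open Classical in D.filter fun s => s.1 j ≤ z

/-- The part of a data set that lies in `{x | z < x j}`. -/
def upper {d : ℕ} (j : Fin d) (z : ℝ) (D : List (Point d × ℝ)) : List (Point d × ℝ) :=
  open Classical in D.filter fun s => z < s.1 j

/-- The objective of the splitting criterion, computed from the `𝓙`-samples of a node. -/
def splitError {d : ℕ} (DJ : List (Point d × ℝ)) (j : Fin d) (z : ℝ) : ℝ :=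
  squaredError (lower j z DJ) + squaredError (upper j z DJ)

/-- The number of points of a list in `{x | x j ≤ z}`. -/
def countLower {d : ℕ} (XI : List (Point d)) (j : Fin d) (z : ℝ) : ℕ :=
  open Classical in (XI.filter fun x => x j ≤ z).length

/-- The number of points of a list in `{x | z < x j}`. -/
def countUpper {d : ℕ} (XI : List (Point d)) (j : Fin d) (z : ℝ) : ℕ :=
  open Classical in (XI.filter fun x => z < x j).length

/-- The split of the rectangle `∏ [lo j, hi j]` of depth `c` at `x j = z` is admissible: `α`-spatial
balance, and at least `β f(c)` of the `𝓘`-points `XI` of the node on either side. If the coin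
`(b, j₀)` has `b = true`, then the direction has to be `j₀`; otherwise it is free. -/
structure Admissible {d : ℕ} (p : Params) (c : ℕ) (coin : Bool × Fin d) (lo hi : Fin d → ℝ)
    (XI : List (Point d)) (s : Fin d × ℝ) : Prop where
  direction : coin.1 = true → s.1 = coin.2
  lower_le : (1 - p.α) * lo s.1 + p.α * hi s.1 ≤ s.2
  le_upper : s.2 ≤ p.α * lo s.1 + (1 - p.α) * hi s.1
  count_lower : p.β * p.f c ≤ countLower XI s.1 s.2
  count_upper : p.β * p.f c ≤ countUpper XI s.1 s.2

/-- What the splitting criterion sees of a node: its rectangle, the positions (not the responses)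
of its `𝓘`-samples, and its `𝓙`-samples. -/
abbrev SplitInput (d : ℕ) : Type :=
  ((Fin d → ℝ) × (Fin d → ℝ)) × (Σ n : ℕ, Fin n → Point d) × (Σ m : ℕ, Fin m → Point d × ℝ)

/-- The input of the splitting criterion from lists of samples. -/
def splitInput {d : ℕ} (lo hi : Fin d → ℝ) (XI : List (Point d)) (DJ : List (Point d × ℝ)) :
    SplitInput d :=
  ((lo, hi), ⟨XI.length, XI.get⟩, ⟨DJ.length, DJ.get⟩)

/-- A map that to depth, coin and node data assigns a split direction and a split value. -/
abbrev SplitRule (d : ℕ) : Type := ℕ → Bool × Fin d → SplitInput d → Fin d × ℝ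

/-- The rule is a (measurable) version of the `argmin` of the splitting criterion: whenever some
split is admissible, it returns an admissible split of minimal error. Ties may be broken in any
way. -/
structure IsSplitRule {d : ℕ} (p : Params) (rule : SplitRule d) : Prop where
  measurable : ∀ c coin, Measurable (rule c coin)
  admissible : ∀ c coin lo hi XI DJ, (∃ s, Admissible p c coin lo hi XI s) →
    Admissible p c coin lo hi XI (rule c coin (splitInput lo hi XI DJ))
  minimal : ∀ c coin lo hi XI DJ s, Admissible p c coin lo hi XI s →
    splitError DJ (rule c coin (splitInput lo hi XI DJ)).1 (rule c coin (splitInput lo hi XI DJ)).2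
      ≤ splitError DJ s.1 s.2

/-! ### Leaves -/

/-- A leaf of the current tree: its address (the left/right turns on the way from the root, the last
one first), its rectangle, its `𝓘`- and `𝓙`-samples (position and response), and how many
samples of either kind were drawn in it since it was created. -/
structure Leaf (d : ℕ) where
  addr : List Bool
  lo : Fin d → ℝ
  hi : Fin d → ℝ
  dataI : List (Point d × ℝ)
  dataJ : List (Point d × ℝ)
  drawnI : ℕ
  drawnJ : ℕ

/-- The depth of a leaf: the number of splits that lead to it. -/
def Leaf.depth {d : ℕ} (L : Leaf d) : ℕ := L.addr.length

/-- The honest sample mean of a leaf: the average response of its `𝓘`-samples. -/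
def Leaf.sampleMean {d : ℕ} (L : Leaf d) : ℝ := average (L.dataI.map Prod.snd)

/-- The child `{x ∈ L | x j ≤ z}`; it inherits the samples of `L` that lie in it. -/
def Leaf.left {d : ℕ} (L : Leaf d) (j : Fin d) (z : ℝ) : Leaf d where
  addr := false :: L.addr
  lo := L.lo
  hi := Function.update L.hi j z
  dataI := lower j z L.dataI
  dataJ := lower j z L.dataJ
  drawnI := 0
  drawnJ := 0

/-- The child `{x ∈ L | z < x j}`; it inherits the samples of `L` that lie in it. -/
def Leaf.right {d : ℕ} (L : Leaf d) (j : Fin d) (z : ℝ) : Leaf d where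
  addr := true :: L.addr
  lo := Function.update L.lo j z
  hi := L.hi
  dataI := upper j z L.dataI
  dataJ := upper j z L.dataJ
  drawnI := 0
  drawnJ := 0

/-- The point of the rectangle of `L` with relative coordinates `u ∈ [0, 1]^d`: uniform in the
rectangle if `u` is uniform in the cube. -/
def Leaf.pointAt {d : ℕ} (L : Leaf d) (u : Point d) : Point d :=
  WithLp.toLp 2 fun j => L.lo j + u j * (L.hi j - L.lo j)

/-! ### The problem and its randomness -/

/-- A simulation model: the response surface `μ` and the simulation noise `ε(x) = noise x ξ`, where
`ξ` has the law `ρ`. So a simulation run at `x` returns `μ x + noise x ξ`. -/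
structure Model (d : ℕ) (Ξ : Type*) [MeasurableSpace Ξ] where
  μ : Point d → ℝ
  noise : Point d → Ξ → ℝ
  ρ : Measure Ξ
  isProbabilityMeasure : IsProbabilityMeasure ρ
  measurable_μ : Measurable μ
  measurable_noise : Measurable (Function.uncurry noise)

/-- The response of a simulation run at `x`. -/
def Model.response {d : ℕ} {Ξ : Type*} [MeasurableSpace Ξ] (M : Model d Ξ) (x : Point d) (ξ : Ξ) :
    ℝ :=
  M.μ x + M.noise x ξ

/-- The simulation noise is centred and sub-Gaussian with variance proxy `σ ^ 2` at every feasible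
point. -/
def Model.SubGaussianNoise {d : ℕ} {Ξ : Type*} [MeasurableSpace Ξ] (M : Model d Ξ) (σ : ℝ≥0) :
    Prop :=
  ∀ x ∈ cube d, ∫ ξ, M.noise x ξ ∂M.ρ = 0 ∧ HasSubgaussianMGF (M.noise x) (σ ^ 2) M.ρ

/-- `xs` is the unique maximizer of `μ` on `[0, 1]^d`. -/
def Model.IsUniqueOptimum {d : ℕ} {Ξ : Type*} [MeasurableSpace Ξ] (M : Model d Ξ) (xs : Point d) :
    Prop :=
  xs ∈ cube d ∧ (∀ x ∈ cube d, M.μ x ≤ M.μ xs) ∧ ∀ x ∈ cube d, M.μ x = M.μ xs → x = xs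

/-- Local smoothness at the optimum: `μ(x*) - μ(x) ≤ C ‖x - x*‖`. -/
def Model.LocallySmooth {d : ℕ} {Ξ : Type*} [MeasurableSpace Ξ] (M : Model d Ξ) (xs : Point d) :
    Prop :=
  ∃ C : ℝ, 0 < C ∧ ∀ x ∈ cube d, M.μ xs - M.μ x ≤ C * ‖x - xs‖

/-- Away from the optimum the values stay below the optimal value by a positive margin. -/
def Model.WellSeparated {d : ℕ} {Ξ : Type*} [MeasurableSpace Ξ] (M : Model d Ξ) (xs : Point d) :
    Prop :=
  ∀ ε : ℝ, 0 < ε → ∃ δ : ℝ, 0 < δ ∧ ∀ x ∈ cube d, ε ≤ ‖x - xs‖ → M.μ x < M.μ xs - δ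

/-- One realization of the random inputs. `draw (a, true, k)` and `draw (a, false, k)` are the
relative position and the simulation input of the `k`-th `𝓘`-sample and the `k`-th `𝓙`-sample
drawn in the node with address `a`; `coin a` is the random choice that the splitting criterion makes
at that node: whether the direction is drawn at random, and which direction is then used. Every draw
is used at most once, so a sample drawn in a leaf is independent of the samples seen before. -/
structure Inputs (d : ℕ) (Ξ : Type*) where
  draw : List Bool × Bool × ℕ → Point d × Ξ
  coin : List Bool → Bool × Fin d

/-- The law of the inputs: the relative positions are uniform in the cube, the simulation inputs have
the law `ρ`, a coin shows `true` with probability `κ` and its direction is uniform, and everything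
is independent. -/
structure IsInputs {d : ℕ} {Ξ : Type*} [MeasurableSpace Ξ] (ρ : Measure Ξ) (κ : ℝ)
    {Ω : Type*} [MeasurableSpace Ω] (P : Measure Ω) (inp : Ω → Inputs d Ξ) : Prop where
  measurable_draw : ∀ i, Measurable fun ω => (inp ω).draw i
  measurable_coin : ∀ a, Measurable fun ω => (inp ω).coin a
  law_draw : ∀ i, P.map (fun ω => (inp ω).draw i) = (volume.restrict (cube d)).prod ρ
  law_coin : ∀ a b j, P {ω | (inp ω).coin a = (b, j)} =
    ENNReal.ofReal ((if b = true then κ else 1 - κ) / d)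
  indep_draw : iIndepFun (fun i ω => (inp ω).draw i) P
  indep_coin : iIndepFun (fun a ω => (inp ω).coin a) P
  indep : IndepFun (fun ω => (inp ω).draw) (fun ω => (inp ω).coin) P

/-! ### The algorithm -/

section Algorithm

variable {d : ℕ} {Ξ : Type*} [MeasurableSpace Ξ]

/-- Draw a uniform point in the leaf, simulate there once, add the result to the `𝓘`-samples. -/
def drawI (M : Model d Ξ) (w : Inputs d Ξ) (L : Leaf d) : Leaf d :=
  let q := w.draw (L.addr, true, L.drawnI)
  { L with
    dataI := L.dataI ++ [(L.pointAt q.1, M.response (L.pointAt q.1) q.2)]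
    drawnI := L.drawnI + 1 }

/-- Draw a uniform point in the leaf, simulate there once, add the result to the `𝓙`-samples. -/
def drawJ (M : Model d Ξ) (w : Inputs d Ξ) (L : Leaf d) : Leaf d :=
  let q := w.draw (L.addr, false, L.drawnJ)
  { L with
    dataJ := L.dataJ ++ [(L.pointAt q.1, M.response (L.pointAt q.1) q.2)]
    drawnJ := L.drawnJ + 1 }

/-- The leaf has reached the number of `𝓘`-samples that triggers a split. -/
def Leaf.Full (p : Params) (L : Leaf d) : Prop := p.f L.depth ≤ (L.dataI.length : ℝ)

/-- The split that the splitting criterion proposes for a leaf. -/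
def proposal (rule : SplitRule d) (w : Inputs d Ξ) (L : Leaf d) : Fin d × ℝ :=
  rule L.depth (w.coin L.addr) (splitInput L.lo L.hi (L.dataI.map Prod.fst) L.dataJ)

open Classical in
/-- Split a leaf that is full by the splitting criterion. If no split is admissible, then the leaf
stays as it is for the time being. -/
def trySplit (p : Params) (rule : SplitRule d) (w : Inputs d Ξ) (L : Leaf d) : List (Leaf d) :=
  let s := proposal rule w L
  if L.Full p ∧ Admissible p L.depth (w.coin L.addr) L.lo L.hi (L.dataI.map Prod.fst) s then
    [L.left s.1 s.2, L.right s.1 s.2]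
  else [L]

/-- A state of the search: the number of simulation runs so far, and the leaves of the tree. -/
structure State (d : ℕ) where
  n : ℕ
  leaves : List (Leaf d)

/-- The root `[0, 1]^d` without samples. -/
def emptyRoot (d : ℕ) : Leaf d := ⟨[], fun _ => 0, fun _ => 1, [], [], 0, 0⟩

/-- The root with the `N₀` samples of stage 1, of which `⌊N₀ / 2⌋` are `𝓘`-samples. -/
def stageOneRoot (M : Model d Ξ) (w : Inputs d Ξ) (N₀ : ℕ) : Leaf d :=
  (drawJ M w)^[N₀ - N₀ / 2] ((drawI M w)^[N₀ / 2] (emptyRoot d))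

/-- Stage 1: grow the tree from the `N₀` samples until no leaf can be split any more. A split leaves
an `𝓘`-sample on either side, so `N₀` rounds suffice. -/
def stageOne (p : Params) (rule : SplitRule d) (M : Model d Ξ) (w : Inputs d Ξ) (N₀ : ℕ) :
    State d where
  n := N₀
  leaves := (fun l : List (Leaf d) => l.flatMap (trySplit p rule w))^[N₀] [stageOneRoot M w N₀]

/-- The number of additional `𝓙`-samples that a full leaf needs. -/
def missingJ (p : Params) (L : Leaf d) : ℕ := ⌈p.f L.depth⌉₊ - L.dataJ.length

open Classical in
/-- One iteration of stage 2 in the selected leaf: draw an `𝓘`-sample; if the leaf is now full, top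
up its `𝓙`-samples and split it. The result is the number of simulation runs and the new leaves
that replace the selected one. -/
def visit (p : Params) (rule : SplitRule d) (M : Model d Ξ) (w : Inputs d Ξ) (L : Leaf d) :
    ℕ × List (Leaf d) :=
  let L' := drawI M w L
  if L'.Full p then
    (1 + missingJ p L', trySplit p rule w ((drawJ M w)^[missingJ p L'] L'))
  else (1, [L'])

open Classical in
/-- One iteration of stage 2, where `a` is the address of the selected leaf. -/
def step (p : Params) (rule : SplitRule d) (M : Model d Ξ) (w : Inputs d Ξ) (a : List Bool)
    (S : State d) : State d :=
  match S.leaves.find? (fun L => L.addr = a) with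
  | none => S
  | some L =>
    { n := S.n + (visit p rule M w L).1
      leaves := S.leaves.filter (fun L' => L'.addr ≠ a) ++ (visit p rule M w L).2 }

/-- A tree search strategy selects (the address of) a leaf from the current state and the list of the
earlier states, the latest first; it may use a random seed in `V`. -/
abbrev Strategy (d : ℕ) (V : Type*) : Type _ := V → State d → List (State d) → List Bool

/-- The strategy always selects a leaf of the current tree. -/
def Strategy.SelectsLeaf {V : Type*} (strat : Strategy d V) : Prop :=
  ∀ v S hist, S.leaves ≠ [] → strat v S hist ∈ S.leaves.map Leaf.addr

/-- One pass of the loop `while n < N`, on a state together with the list of the earlier ones. -/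
def loopBody {V : Type*} (p : Params) (rule : SplitRule d) (M : Model d Ξ) (strat : Strategy d V)
    (w : Inputs d Ξ) (v : V) (N : ℕ) (h : State d × List (State d)) : State d × List (State d) :=
  if h.1.n < N then (step p rule M w (strat v h.1 h.2) h.1, h.1 :: h.2) else h

/-- The leaves of the tree when the search with budget `N` stops. Every pass of the loop uses at
least one simulation run, so `N` passes suffice. -/
def finalLeaves {V : Type*} (p : Params) (rule : SplitRule d) (M : Model d Ξ)
    (strat : Strategy d V) (N₀ : ℕ) (w : Inputs d Ξ) (v : V) (N : ℕ) : List (Leaf d) :=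
  ((loopBody p rule M strat w v N)^[N] (stageOne p rule M w N₀, [])).1.leaves

end Algorithm

end

end RegularTreeSearch

namespace RegularTreeSearch

noncomputable section

/-! The search chooses leaves adaptively, so the samples of a leaf are not a batch of fixed size.
However, draws and coins are indexed by address and running number. The data of a leaf are therefore
determined by its address `a` and the number `k` of its visits: they are `(grow p M w)^[k]` applied
to the leaf of `node p rule M N₀ w a`, a function of the random inputs alone. The strategy only
decides which pairs `(a, k)` occur (`isCurrent_finalLeaves`), so whatever holds for all pairs at
once holds for every strategy.

Noise. Splits see the positions of the 𝓘-samples but not their responses, so resampling the 𝓘-noise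
leaves the shape of every node unchanged (`isSkeleton_node`). With all else frozen, the total
deviation in a node of depth `n + 1` after `k` visits is a sum of at least `β f(n) + k` independent
sub-Gaussian terms, and Hoeffding bounds the probability of a large average by `2 exp(-θ (β f(n) +
k))`. The sum over `k` is geometric, and the `2 ^ (n + 1)` addresses are outweighed once `f` grows
faster than any linear function (`tendsto_measure_noisy`).

This growth comes from the depth conditions (`eventually_mul_le_threshold`). One more unit of budget
allows at most one more step, and a step deepens a leaf by at most one. At the first budget where
the lower depth bound exceeds `c`, the preceding budget has lower bound at most `c` and upper bound
at least `c`; the ratio condition there gives `A c ≤ f(c)`.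

Bias. Only one node per level lies on the path of `x*`. Its coin is independent of its rectangle and
forces direction `j` with probability `κ / d`, in which case side `j` shrinks by the factor `1 - α`
or more. The expected side at depth `c` is thus at most `(1 - α κ / d) ^ c`, which is summable, and
the late rectangles around `x*` are uniformly small (`tendsto_measure_pathSide`).

Conclusion. With high probability all leaf means are within `ε / 4` of the average of `μ` over their
𝓘-points. No mean then exceeds `μ(x*) + ε / 4`, while by Lipschitz continuity at `x*` the leaf
around `x*` has mean at least `μ(x*) - ε / 2`. The maximal mean lies in between. -/

/-! ### Product measures -/

/-- A coordinatewise measure preserving combination of two independent families of independent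
variables is a family of independent variables. -/
theorem map_infinitePi_prod_infinitePi {ι A B C : Type*} [MeasurableSpace A] [MeasurableSpace B]
    [MeasurableSpace C] (μ : ι → Measure A) (ν : ι → Measure B) (η : ι → Measure C)
    [∀ i, IsProbabilityMeasure (μ i)] [∀ i, IsProbabilityMeasure (ν i)]
    [∀ i, IsProbabilityMeasure (η i)] (φ : ι → A × B → C) (hφ : ∀ i, Measurable (φ i))
    (h : ∀ i, ((μ i).prod (ν i)).map (φ i) = η i) :
    ((Measure.infinitePi μ).prod (Measure.infinitePi ν)).map
      (fun z i => φ i (z.1 i, z.2 i)) = Measure.infinitePi η := by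
  have hm : Measurable (fun (z : (ι → A) × (ι → B)) i => φ i (z.1 i, z.2 i)) :=
    measurable_pi_lambda _ fun i => (hφ i).comp (by fun_prop)
  refine Measure.eq_infinitePi _ fun s t ht => ?_
  rw [Measure.map_apply hm (MeasurableSet.pi s.countable_toSet fun i _ => ht i)]
  have h1 : MeasurableSet (Set.univ.pi fun i : s => (φ i ⁻¹' t i)) :=
    MeasurableSet.univ_pi fun i => hφ i (ht i)
  have h2 := (measurePreserving_arrowProdEquivProdArrow A B s (fun i => μ i) (fun i => ν i)).symm
  have h3 : MeasurePreserving (fun z : (ι → A) × (ι → B) => (s.restrict z.1, s.restrict z.2))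
      ((Measure.infinitePi μ).prod (Measure.infinitePi ν))
      ((Measure.pi fun i : s => μ i).prod (Measure.pi fun i : s => ν i)) :=
    MeasurePreserving.prod ⟨by fun_prop, Measure.infinitePi_map_restrict μ⟩
      ⟨by fun_prop, Measure.infinitePi_map_restrict ν⟩
  have h4 := (h2.comp h3).measure_preimage h1.nullMeasurableSet
  rw [Measure.pi_pi] at h4
  have h5 : ∏ i : s, ((μ i).prod (ν i)) (φ i ⁻¹' t i) = ∏ i ∈ s, η i (t i) := by
    rw [← Finset.prod_coe_sort s (fun i => η i (t i))]
    refine Finset.prod_congr rfl fun i _ => ?_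
    rw [← h i, Measure.map_apply (hφ i) (ht i)]
  rw [← h5, ← h4]
  congr 1
  ext z
  simp [Set.mem_pi, MeasurableEquiv.arrowProdEquivProdArrow, Equiv.arrowProdEquivProdArrow]

/-! ### Sub-Gaussian concentration. -/

theorem HasSubgaussianMGF_mono {Ω : Type*} [MeasurableSpace Ω] {P : Measure Ω} {X : Ω → ℝ}
    {c c' : ℝ≥0} (h : HasSubgaussianMGF X c P) (hc : c ≤ c') : HasSubgaussianMGF X c' P where
  integrable_exp_mul := h.integrable_exp_mul
  mgf_le t := (h.mgf_le t).trans (by gcongr)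

/-- Two-sided Hoeffding inequality for the average of independent sub-Gaussian variables. -/
theorem measure_list_sum_ge_le {ι α Ξ : Type*} [MeasurableSpace Ξ] (ρ : Measure Ξ)
    [IsProbabilityMeasure ρ] (g : α → Ξ → ℝ) (hg : ∀ x, Measurable (g x)) {c : ℝ≥0} (hc : 0 < c)
    (l : List (α × ι)) (hl : (l.map Prod.snd).Nodup)
    (hsub : ∀ q ∈ l, HasSubgaussianMGF (g q.1) c ρ) {δ : ℝ} (hδ : 0 < δ) (hne : l ≠ []) :
    Measure.infinitePi (fun _ : ι => ρ)
      {ξ | δ * l.length ≤ |(l.map fun q => g q.1 (ξ q.2)).sum|} ≤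
      ENNReal.ofReal (2 * Real.exp (-(δ ^ 2 / (2 * c)) * l.length)) := by
  set Q := Measure.infinitePi (fun _ : ι => ρ)
  set n := l.length
  have hn : 0 < n := List.length_pos_iff.2 hne
  -- Points may repeat in `l`, but the indices do not: the terms are functions of different
  -- coordinates of `ξ`, hence independent.
  have hinj : Function.Injective (fun i : Fin n => (l.get i).2) := by
    have := List.nodup_iff_injective_get.1 hl
    intro i j hij
    have := @this ⟨i, by simp [n]⟩ ⟨j, by simp [n]⟩ (by simpa using hij)
    simpa [Fin.ext_iff] using this
  have hind0 : iIndepFun (fun (i : ι) (ξ : ι → Ξ) => ξ i) Q :=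
    iIndepFun_infinitePi (X := fun _ x => x) (fun _ => measurable_id)
  have hind : iIndepFun (fun (i : Fin n) (ξ : ι → Ξ) => g (l.get i).1 (ξ (l.get i).2)) Q :=
    (hind0.precomp hinj).comp (fun i => g (l.get i).1) fun i => hg _
  have hsubi : ∀ i ∈ (Finset.univ : Finset (Fin n)),
      HasSubgaussianMGF (fun ξ : ι → Ξ => g (l.get i).1 (ξ (l.get i).2)) c Q := by
    intro i _
    have hmap : Q.map (fun ξ => ξ (l.get i).2) = ρ := Measure.infinitePi_map_eval _ _
    refine HasSubgaussianMGF.of_map (Y := fun ξ : ι → Ξ => ξ (l.get i).2)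
      (X := g (l.get i).1) (measurable_pi_apply _).aemeasurable ?_
    rw [hmap]
    exact hsub _ (l.get_mem i)
  have hsum := HasSubgaussianMGF.sum_of_iIndepFun hind hsubi
  have heq : ∀ ξ : ι → Ξ, (l.map fun q => g q.1 (ξ q.2)).sum
      = ∑ i : Fin n, g (l.get i).1 (ξ (l.get i).2) := by
    intro ξ
    rw [← List.sum_ofFn]
    congr 1
    apply List.ext_get <;> simp [n]
  have hval : (-(δ * n) ^ 2 / (2 * ((∑ i : Fin n, c : ℝ≥0) : ℝ))) = -(δ ^ 2 / (2 * c)) * n := by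
    have hn' : (n : ℝ) ≠ 0 := by positivity
    have hc' : (c : ℝ) ≠ 0 := by positivity
    simp only [Finset.sum_const, Finset.card_univ, Fintype.card_fin, nsmul_eq_mul]
    push_cast
    field_simp
  have h1 := hsum.measure_ge_le (ε := δ * n) (by positivity)
  have h2 := hsum.neg.measure_ge_le (ε := δ * n) (by positivity)
  rw [hval] at h1 h2
  refine (measure_mono (t := {ξ | δ * n ≤ ∑ i : Fin n, g (l.get i).1 (ξ (l.get i).2)} ∪
    {ξ | δ * n ≤ (-fun ξ : ι → Ξ => ∑ i : Fin n, g (l.get i).1 (ξ (l.get i).2)) ξ}) ?_).trans ?_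
  · intro ξ hξ
    simp only [Set.mem_ofPred_eq, heq, Set.mem_union, Pi.neg_apply] at hξ ⊢
    exact le_abs.1 hξ
  · refine (measure_union_le _ _).trans ?_
    rw [two_mul, ENNReal.ofReal_add (Real.exp_nonneg _) (Real.exp_nonneg _)]
    gcongr
    · rw [← ofReal_measureReal]; exact ENNReal.ofReal_le_ofReal h1
    · rw [← ofReal_measureReal]; exact ENNReal.ofReal_le_ofReal h2

/-! ### Measurability of list-valued maps -/

section Lists

variable {Ω α β : Type*} [MeasurableSpace Ω] [MeasurableSpace α] [MeasurableSpace β]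

/-- A countable discrete index reduces joint measurability to measurability for each fixed index. It
serves wherever a random number, coin or direction selects the map: running numbers of draws, top-up
sizes, split times. -/
theorem measurable_apply_countable {ι : Type*} [MeasurableSpace ι] [Countable ι]
    [MeasurableSingletonClass ι] {F : ι → Ω → β} (hF : ∀ i, Measurable (F i)) {m : Ω → ι}
    (hm : Measurable m) : Measurable fun w => F (m w) w :=
  (measurable_from_prod_countable_right (f := fun q : ι × Ω => F q.1 q.2) hF).comp
    (hm.prodMk measurable_id)

/-- The σ-algebra on lists that is generated by the length and the entries. -/
instance List.instMeasurableSpace [Inhabited α] : MeasurableSpace (List α) :=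
  MeasurableSpace.comap List.length ⊤ ⊔
    ⨆ i : ℕ, MeasurableSpace.comap (fun l : List α => l.getD i default) ‹_›

variable [Inhabited α] [Inhabited β]

theorem measurable_list_iff {F : Ω → List α} : Measurable F ↔
    (Measurable fun w => (F w).length) ∧ ∀ i, Measurable fun w => (F w).getD i default := by
  simp only [measurable_iff_comap_le, List.instMeasurableSpace, MeasurableSpace.comap_sup,
    sup_le_iff, MeasurableSpace.comap_iSup, iSup_le_iff, MeasurableSpace.comap_comp]
  rfl

theorem measurable_list_nil : Measurable fun _ : Ω => ([] : List α) := measurable_const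

theorem measurable_list_cons {x : Ω → α} {F : Ω → List α} (hx : Measurable x)
    (hF : Measurable F) : Measurable fun w => x w :: F w := by
  rw [measurable_list_iff] at hF ⊢
  refine ⟨by simpa using hF.1.add_const 1, fun i => ?_⟩
  cases i with
  | zero => simpa using hx
  | succ i => simpa using hF.2 i

theorem measurable_list_ofFn {n : ℕ} {x : Fin n → Ω → α} (hx : ∀ i, Measurable (x i)) :
    Measurable fun w => List.ofFn fun i => x i w := by
  induction n with
  | zero => simp
  | succ n ih =>
    simp only [List.ofFn_succ]
    exact measurable_list_cons (hx 0) (ih fun i => hx _)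

/-- To show that a functional of a list depends measurably on the outcome, we may assume that the
list has constant length. -/
theorem measurable_of_list {γ : Type*} [MeasurableSpace γ] {G : Ω → List α → γ} {F : Ω → List α}
    (hF : Measurable F)
    (hG : ∀ (n : ℕ) (x : Fin n → Ω → α), (∀ i, Measurable (x i)) →
      Measurable fun w => G w (List.ofFn fun i => x i w)) : Measurable fun w => G w (F w) := by
  rw [measurable_list_iff] at hF
  -- Slice by the length `n`. Thanks to the default value, the first `n` entries are measurable on
  -- all of `Ω`, not only where the list is long enough.
  have := measurable_apply_countable
    (F := fun n w => G w (List.ofFn fun i : Fin n => (F w).getD i default))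
    (fun n => hG n (fun i w => (F w).getD i default) fun i => hF.2 i) hF.1
  convert this using 3 with w
  apply List.ext_get <;> simp

theorem measurable_list_append_singleton {x : Ω → α} {F : Ω → List α} (hx : Measurable x)
    (hF : Measurable F) : Measurable fun w => F w ++ [x w] := by
  refine measurable_of_list (G := fun w l => l ++ [x w]) hF fun n y hy => ?_
  induction n with
  | zero => simpa using measurable_list_cons hx measurable_list_nil
  | succ n ih =>
    simp only [List.ofFn_succ, List.cons_append]
    exact measurable_list_cons (hy 0) (ih _ fun i => hy _)

theorem measurable_list_map {g : α → β} (hg : Measurable g) {F : Ω → List α}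
    (hF : Measurable F) : Measurable fun w => (F w).map g := by
  refine measurable_of_list (G := fun _ l => l.map g) hF fun n y hy => ?_
  simp only [List.map_ofFn]
  exact measurable_list_ofFn fun i => hg.comp (hy i)

theorem measurable_list_filter {q : Ω → α → Prop} [∀ w, DecidablePred (q w)] {F : Ω → List α}
    (hq : ∀ x : Ω → α, Measurable x → MeasurableSet {w | q w (x w)}) (hF : Measurable F) :
    Measurable fun w => (F w).filter fun s => q w s := by
  refine measurable_of_list (G := fun w l => l.filter fun s => q w s) hF fun n y hy => ?_
  induction n with
  | zero => simp
  | succ n ih =>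
    simp only [List.ofFn_succ, List.filter_cons, decide_eq_true_eq]
    exact Measurable.ite (hq _ (hy 0)) (measurable_list_cons (hy 0) (ih _ fun i => hy _))
      (ih _ fun i => hy _)

theorem measurable_list_sum {F : Ω → List ℝ} (hF : Measurable F) :
    Measurable fun w => (F w).sum := by
  refine measurable_of_list (G := fun _ l => l.sum) hF fun n y hy => ?_
  simp only [List.sum_ofFn]
  exact Finset.measurable_sum _ fun i _ => hy i

theorem measurable_list_length {F : Ω → List α} (hF : Measurable F) :
    Measurable fun w => (F w).length := (measurable_list_iff.1 hF).1

theorem measurable_sigma_mk {ι : Type*} {X : ι → Type*} [∀ i, MeasurableSpace (X i)] (i : ι) :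
    Measurable (Sigma.mk i : X i → Sigma X) := by
  rw [measurable_iff_le_map]
  exact iInf_le _ i

theorem measurable_list_get {F : Ω → List α} (hF : Measurable F) :
    Measurable fun w => (⟨(F w).length, (F w).get⟩ : Σ n : ℕ, Fin n → α) := by
  refine measurable_of_list (G := fun _ l => (⟨l.length, l.get⟩ : Σ n : ℕ, Fin n → α)) hF
    fun n y hy => ?_
  have : (fun w => (⟨(List.ofFn fun i => y i w).length, (List.ofFn fun i => y i w).get⟩ :
      Σ n : ℕ, Fin n → α)) = fun w => ⟨n, fun i => y i w⟩ := by
    funext w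
    exact (List.equivSigmaTuple (α := α)).right_inv ⟨n, fun i => y i w⟩
  rw [this]
  exact (measurable_sigma_mk n).comp (measurable_pi_lambda _ fun i => hy i)

end Lists

/-! ### The tree of potential nodes -/

section Nodes

set_option linter.unusedSectionVars false

variable {d : ℕ} {Ξ : Type*} [MeasurableSpace Ξ]

open Classical in
/-- The effect of a visit on the samples of a leaf: one more `𝓘`-sample, and, if the leaf is then
full, a top-up of the `𝓙`-samples. -/
def grow (p : Params) (M : Model d Ξ) (w : Inputs d Ξ) (L : Leaf d) : Leaf d :=
  let L' := drawI M w L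
  if L'.Full p then (drawJ M w)^[missingJ p L'] L' else L'

/-- The leaf is full and the split that is proposed for it is admissible. -/
def Splits (p : Params) (rule : SplitRule d) (w : Inputs d Ξ) (L : Leaf d) : Prop :=
  L.Full p ∧ Admissible p L.depth (w.coin L.addr) L.lo L.hi (L.dataI.map Prod.fst)
    (proposal rule w L)

/-- The left or right child that results from the proposed split. -/
def child (rule : SplitRule d) (w : Inputs d Ξ) (L : Leaf d) (b : Bool) : Leaf d :=
  if b then L.right (proposal rule w L).1 (proposal rule w L).2
  else L.left (proposal rule w L).1 (proposal rule w L).2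

/-- A node at its creation: its leaf, whether it may split before the first visit (because it is
created in stage 1), and whether the node can be created at all. -/
structure Node (d : ℕ) where
  leaf : Leaf d
  early : Bool
  alive : Bool

/-- The node splits after `k` visits, if it is still a leaf then. -/
def Node.SplitsAt (p : Params) (rule : SplitRule d) (M : Model d Ξ) (w : Inputs d Ξ) (V : Node d)
    (k : ℕ) : Prop :=
  (V.early = true ∨ k ≠ 0) ∧ Splits p rule w ((grow p M w)^[k] V.leaf)

open Classical in
/-- The number of visits after which the node splits (`0` if it never splits). -/
def Node.splitTime (p : Params) (rule : SplitRule d) (M : Model d Ξ) (w : Inputs d Ξ)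
    (V : Node d) : ℕ :=
  if h : ∃ k, V.SplitsAt p rule M w k then Nat.find h else 0

/-- The leaf at the time of its split. -/
def Node.last (p : Params) (rule : SplitRule d) (M : Model d Ξ) (w : Inputs d Ξ) (V : Node d) :
    Leaf d :=
  (grow p M w)^[V.splitTime p rule M w] V.leaf

open Classical in
/-- The node with a given address. It is a function of the random inputs alone: a strategy decides
whether and when it is created, but not how it looks like. -/
def node (p : Params) (rule : SplitRule d) (M : Model d Ξ) (N₀ : ℕ) (w : Inputs d Ξ) :
    List Bool → Node d
  | [] => ⟨stageOneRoot M w N₀, decide (0 < N₀), true⟩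
  | b :: a =>
    let V := node p rule M N₀ w a
    { leaf := child rule w (V.last p rule M w) b
      early := V.early && decide (V.splitTime p rule M w = 0) && decide (a.length + 1 < N₀)
      alive := V.alive && decide (∃ k, V.SplitsAt p rule M w k) }

/-- The leaf is a node that has been visited some number of times and was not split so far. -/
def IsCurrent (p : Params) (rule : SplitRule d) (M : Model d Ξ) (N₀ : ℕ) (w : Inputs d Ξ)
    (L : Leaf d) : Prop :=
  (node p rule M N₀ w L.addr).alive = true ∧
  ∃ k, L = (grow p M w)^[k] (node p rule M N₀ w L.addr).leaf ∧
    ∀ k' ≤ k, ¬ (node p rule M N₀ w L.addr).SplitsAt p rule M w k'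

/-- The address belongs to the nodes whose rectangles contain the point `x`. -/
def OnPath (p : Params) (rule : SplitRule d) (M : Model d Ξ) (N₀ : ℕ) (x : Point d)
    (w : Inputs d Ξ) : List Bool → Prop
  | [] => True
  | b :: a => OnPath p rule M N₀ x w a ∧
      (b = true ↔ (proposal rule w ((node p rule M N₀ w a).last p rule M w)).2 <
        x (proposal rule w ((node p rule M N₀ w a).last p rule M w)).1)

/-! ### Growing leaves and their identification with nodes. -/

variable (p : Params) (rule : SplitRule d) (M : Model d Ξ) (N₀ : ℕ) (w : Inputs d Ξ)

/-- A property of leaves that is kept by every draw is kept by the growth of a leaf. -/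
theorem grow_induction {q : Leaf d → Prop} (hI : ∀ L, q L → q (drawI M w L))
    (hJ : ∀ L, q L → q (drawJ M w L)) {L : Leaf d} (hL : q L) : q (grow p M w L) := by
  have hit : ∀ n L, q L → q ((drawJ M w)^[n] L) := by
    intro n
    induction n with
    | zero => exact fun L h => h
    | succ n ih => exact fun L h => by rw [Function.iterate_succ_apply]; exact ih _ (hJ _ h)
  unfold grow
  dsimp only
  split_ifs
  · exact hit _ _ (hI _ hL)
  · exact hI _ hL

theorem iterate_induction {α : Type*} {q : α → Prop} {f : α → α} (hf : ∀ x, q x → q (f x)) {x : α}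
    (hx : q x) (k : ℕ) : q (f^[k] x) := by
  induction k generalizing x with
  | zero => exact hx
  | succ k ih => rw [Function.iterate_succ_apply]; exact ih (hf _ hx)

theorem iterate_grow_induction {q : Leaf d → Prop} (hI : ∀ L, q L → q (drawI M w L))
    (hJ : ∀ L, q L → q (drawJ M w L)) {L : Leaf d} (hL : q L) (k : ℕ) :
    q ((grow p M w)^[k] L) :=
  iterate_induction (fun _ h => grow_induction p M w hI hJ h) hL k

theorem grow_addr (L : Leaf d) (k : ℕ) : ((grow p M w)^[k] L).addr = L.addr :=
  iterate_grow_induction p M w (q := fun L' => L'.addr = L.addr) (fun _ h => h) (fun _ h => h) rfl k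

theorem grow_lo (L : Leaf d) (k : ℕ) : ((grow p M w)^[k] L).lo = L.lo :=
  iterate_grow_induction p M w (q := fun L' => L'.lo = L.lo) (fun _ h => h) (fun _ h => h) rfl k

theorem grow_hi (L : Leaf d) (k : ℕ) : ((grow p M w)^[k] L).hi = L.hi :=
  iterate_grow_induction p M w (q := fun L' => L'.hi = L.hi) (fun _ h => h) (fun _ h => h) rfl k

theorem drawJ_iterate_dataI (L : Leaf d) (n : ℕ) : ((drawJ M w)^[n] L).dataI = L.dataI :=
  iterate_induction (q := fun L' : Leaf d => L'.dataI = L.dataI) (f := drawJ M w) (fun _ h => h)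
    rfl n

theorem grow_dataI (L : Leaf d) : (grow p M w L).dataI = (drawI M w L).dataI := by
  unfold grow
  dsimp only
  split_ifs
  · exact drawJ_iterate_dataI M w _ _
  · rfl

/-- Top-ups touch only the 𝓙-samples, so each visit adds exactly one 𝓘-sample. This is the `k` that
makes the noise bound summable over the number of visits. -/
theorem length_dataI_grow (L : Leaf d) (k : ℕ) :
    ((grow p M w)^[k] L).dataI.length = L.dataI.length + k := by
  induction k with
  | zero => rfl
  | succ k ih =>
    rw [Function.iterate_succ_apply', grow_dataI]
    simp only [drawI, List.length_append, List.length_singleton, ih]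
    omega

theorem child_addr (L : Leaf d) (b : Bool) : (child rule w L b).addr = b :: L.addr := by
  cases b <;> rfl

theorem node_addr (a : List Bool) : (node p rule M N₀ w a).leaf.addr = a := by
  induction a with
  | nil =>
    exact iterate_induction (q := fun L : Leaf d => L.addr = []) (f := drawJ M w) (fun _ h => h)
      (iterate_induction (q := fun L : Leaf d => L.addr = []) (f := drawI M w) (fun _ h => h)
        (x := emptyRoot d) rfl _) _
  | cons b a ih =>
    simp only [node, child_addr, Node.last, grow_addr, ih]

theorem last_addr (a : List Bool) : ((node p rule M N₀ w a).last p rule M w).addr = a := by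
  rw [Node.last, grow_addr, node_addr]

theorem splitTime_eq {V : Node d} {k : ℕ} (hk : V.SplitsAt p rule M w k)
    (hlt : ∀ k' < k, ¬ V.SplitsAt p rule M w k') : V.splitTime p rule M w = k := by
  classical
  unfold Node.splitTime
  rw [dif_pos ⟨k, hk⟩, Nat.find_eq_iff]
  exact ⟨hk, hlt⟩

/-- The split time depends only on the predicate `SplitsAt`; this transports it both when noise and
when coins are resampled. -/
theorem splitTime_congr {V V' : Node d} {w w' : Inputs d Ξ}
    (h : ∀ k, V.SplitsAt p rule M w k ↔ V'.SplitsAt p rule M w' k) :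
    V.splitTime p rule M w = V'.splitTime p rule M w' := by
  classical
  unfold Node.splitTime
  by_cases h1 : ∃ k, V.SplitsAt p rule M w k
  · have h2 : ∃ k, V'.SplitsAt p rule M w' k := h1.imp fun k => (h k).1
    rw [dif_pos h1, dif_pos h2]
    exact Nat.find_congr' fun {k} => h k
  · have h2 : ¬ ∃ k, V'.SplitsAt p rule M w' k := fun h2 => h1 (h2.imp fun k => (h k).2)
    rw [dif_neg h1, dif_neg h2]

theorem splitsAt_splitTime {V : Node d} (h : ∃ k, V.SplitsAt p rule M w k) :
    V.SplitsAt p rule M w (V.splitTime p rule M w) := by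
  classical
  unfold Node.splitTime
  rw [dif_pos h]
  exact Nat.find_spec h

theorem alive_cons {b : Bool} {a : List Bool} (h : (node p rule M N₀ w (b :: a)).alive = true) :
    (node p rule M N₀ w a).alive = true ∧
      Splits p rule w ((node p rule M N₀ w a).last p rule M w) := by
  simp only [node, Bool.and_eq_true, decide_eq_true_eq] at h
  exact ⟨h.1, (splitsAt_splitTime p rule M w h.2).2⟩

theorem trySplit_eq (L : Leaf d) : trySplit p rule w L =
    open Classical in if Splits p rule w L then [child rule w L false, child rule w L true]
      else [L] := by
  classical
  unfold trySplit Splits child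
  simp

/-- A leaf that is not full after its draw gets no top-up, and `trySplit` returns it unchanged; so
both branches of a visit have the form "grow, then try to split". -/
theorem visit_snd (L : Leaf d) :
    (visit p rule M w L).2 = trySplit p rule w (grow p M w L) := by
  unfold visit grow
  dsimp only
  split_ifs with h
  · rfl
  · rw [trySplit_eq, if_neg]
    exact fun h' => h h'.1

theorem visit_fst_pos (L : Leaf d) : 1 ≤ (visit p rule M w L).1 := by
  unfold visit
  dsimp only
  split_ifs <;> simp

/-- The leaves that replace a leaf at a visit or during stage 1. Here `k` is the number of visits
so far. -/
theorem isCurrent_of_mem_trySplit {a : List Bool} {k : ℕ}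
    (halive : (node p rule M N₀ w a).alive = true)
    (hlt : ∀ k' < k, ¬ (node p rule M N₀ w a).SplitsAt p rule M w k')
    (hk : (node p rule M N₀ w a).early = true ∨ k ≠ 0) {L' : Leaf d}
    (hL' : L' ∈ trySplit p rule w ((grow p M w)^[k] (node p rule M N₀ w a).leaf)) :
    (L' = (grow p M w)^[k] (node p rule M N₀ w a).leaf ∧
      ¬ (node p rule M N₀ w a).SplitsAt p rule M w k) ∨
    (∃ b, L'.addr = b :: a ∧ (node p rule M N₀ w (b :: a)).alive = true ∧
      L' = (node p rule M N₀ w (b :: a)).leaf ∧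
      (node p rule M N₀ w (b :: a)).early =
        ((node p rule M N₀ w a).early && decide (k = 0) && decide (a.length + 1 < N₀))) := by
  classical
  rw [trySplit_eq] at hL'
  split_ifs at hL' with h
  · right
    have hs : (node p rule M N₀ w a).SplitsAt p rule M w k := ⟨hk, h⟩
    -- A split now and none before identifies `k` as the split time, so the children made by the
    -- algorithm are those in the definition of `node`.
    have ht := splitTime_eq p rule M w hs hlt
    have : ∃ b, L' = child rule w ((grow p M w)^[k] (node p rule M N₀ w a).leaf) b := by
      simp only [List.mem_cons, List.not_mem_nil, or_false] at hL'
      exact hL'.elim (fun h => ⟨_, h⟩) fun h => ⟨_, h⟩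
    obtain ⟨b, rfl⟩ := this
    refine ⟨b, by rw [child_addr, grow_addr, node_addr], ?_, ?_, ?_⟩
    · simp only [node, halive, Bool.true_and, decide_eq_true_eq]
      exact ⟨k, hs⟩
    · simp only [node, Node.last, ht]
    · simp only [node, ht]
  · left
    simp only [List.mem_cons, List.not_mem_nil, or_false] at hL'
    exact ⟨hL', fun hs => h hs.2⟩

/-- If a leaf is on the path of `x`, then so is one of the leaves that replace it. -/
theorem exists_onPath_trySplit {x : Point d} {a : List Bool} {k : ℕ}
    (hpath : OnPath p rule M N₀ x w a)
    (hlt : ∀ k' < k, ¬ (node p rule M N₀ w a).SplitsAt p rule M w k')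
    (hk : (node p rule M N₀ w a).early = true ∨ k ≠ 0) :
    ∃ L' ∈ trySplit p rule w ((grow p M w)^[k] (node p rule M N₀ w a).leaf),
      OnPath p rule M N₀ x w L'.addr := by
  classical
  rw [trySplit_eq]
  split_ifs with h
  · have ht := splitTime_eq p rule M w (V := node p rule M N₀ w a) ⟨hk, h⟩ hlt
    have hlast : (node p rule M N₀ w a).last p rule M w =
        (grow p M w)^[k] (node p rule M N₀ w a).leaf := by rw [Node.last, ht]
    set s := proposal rule w ((grow p M w)^[k] (node p rule M N₀ w a).leaf) with hs
    refine ⟨child rule w ((grow p M w)^[k] (node p rule M N₀ w a).leaf) (decide (s.2 < x s.1)),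
      ?_, ?_⟩
    · cases decide (s.2 < x s.1) <;> simp
    · rw [child_addr, grow_addr, node_addr]
      refine ⟨hpath, ?_⟩
      rw [hlast, ← hs, decide_eq_true_eq]
  · exact ⟨_, List.mem_singleton.2 rfl, by rwa [grow_addr, node_addr]⟩

/-! ### Stage 1 -/

/-- A leaf after `r` rounds either was created in round `r`, and then has depth `r`, or was tried
and not split. No data arrive in stage 1, so such a leaf is never split in it. Hence `early` need
only record whether another round follows, that is `r < N₀`. -/
theorem stageOne_invariant (r : ℕ) (hr : r ≤ N₀) :
    ∀ L ∈ (fun l : List (Leaf d) => l.flatMap (trySplit p rule w))^[r] [stageOneRoot M w N₀],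
      (node p rule M N₀ w L.addr).alive = true ∧ L = (node p rule M N₀ w L.addr).leaf ∧
      ((L.addr.length = r ∧ (node p rule M N₀ w L.addr).early = decide (r < N₀)) ∨
        (¬ Splits p rule w L)) := by
  classical
  induction r with
  | zero =>
    intro L hL
    simp only [Function.iterate_zero, id_eq, List.mem_singleton] at hL
    subst hL
    have : (stageOneRoot M w N₀).addr = [] := node_addr p rule M N₀ w []
    rw [this]
    exact ⟨rfl, rfl, Or.inl ⟨rfl, rfl⟩⟩
  | succ r ih =>
    intro L hL
    rw [Function.iterate_succ_apply', List.mem_flatMap] at hL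
    obtain ⟨L₀, hL₀, hL⟩ := hL
    obtain ⟨h1, h2, h3⟩ := ih (by omega) L₀ hL₀
    by_cases hs : Splits p rule w L₀
    · obtain ⟨h4, h5⟩ := h3.resolve_right (not_not_intro hs)
      have h5' : (node p rule M N₀ w L₀.addr).early = true := by rw [h5]; simp; omega
      have hL' : L ∈ trySplit p rule w
          ((grow p M w)^[0] (node p rule M N₀ w L₀.addr).leaf) := by
        rw [Function.iterate_zero, id, ← h2]; exact hL
      rcases isCurrent_of_mem_trySplit p rule M N₀ w h1 (fun k' hk' => absurd hk' (by omega))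
        (Or.inl h5') hL' with ⟨-, h7⟩ | ⟨b, h6, h7, h8, h9⟩
      · refine absurd ⟨Or.inl h5', ?_⟩ h7
        rw [Function.iterate_zero, id, ← h2]; exact hs
      · rw [h6]
        refine ⟨h7, h8, Or.inl ⟨by simp [h4], ?_⟩⟩
        rw [h9, h5', h4]
        simp
    · rw [trySplit_eq, if_neg hs, List.mem_singleton] at hL
      subst hL
      exact ⟨h1, h2, Or.inr hs⟩

theorem isCurrent_stageOne {L : Leaf d} (hL : L ∈ (stageOne p rule M w N₀).leaves) :
    IsCurrent p rule M N₀ w L := by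
  obtain ⟨h1, h2, h3⟩ := stageOne_invariant p rule M N₀ w N₀ le_rfl L hL
  refine ⟨h1, 0, h2, fun k' hk' => ?_⟩
  obtain rfl : k' = 0 := by omega
  rintro ⟨h4, h5⟩
  rw [Function.iterate_zero, id, ← h2] at h5
  -- A leaf of depth `N₀` gets no further round. Its `early` flag is false, so it does not count as
  -- splitting at time `0` even if an admissible split exists.
  rcases h3 with ⟨-, h6⟩ | h6
  · simp [h6] at h4
  · exact h6 h5

theorem exists_onPath_stageOne (x : Point d) :
    ∃ L ∈ (stageOne p rule M w N₀).leaves, OnPath p rule M N₀ x w L.addr := by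
  classical
  have : ∀ r ≤ N₀, ∃ L ∈ (fun l : List (Leaf d) => l.flatMap (trySplit p rule w))^[r]
      [stageOneRoot M w N₀], OnPath p rule M N₀ x w L.addr := by
    intro r hr
    induction r with
    | zero =>
      refine ⟨stageOneRoot M w N₀, by simp, ?_⟩
      rw [show (stageOneRoot M w N₀).addr = [] from node_addr p rule M N₀ w []]
      trivial
    | succ r ih =>
      obtain ⟨L, hL, hpath⟩ := ih (by omega)
      obtain ⟨h1, h2, h3⟩ := stageOne_invariant p rule M N₀ w r (by omega) L hL
      simp only [Function.iterate_succ_apply', List.mem_flatMap]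
      by_cases hs : Splits p rule w L
      · obtain ⟨h4, h5⟩ := h3.resolve_right (not_not_intro hs)
        have h5' : (node p rule M N₀ w L.addr).early = true := by rw [h5]; simp; omega
        obtain ⟨L', h6, h7⟩ := exists_onPath_trySplit p rule M N₀ w hpath (k := 0)
          (fun k' hk' => absurd hk' (by omega)) (Or.inl h5')
        refine ⟨L', ⟨L, hL, ?_⟩, h7⟩
        rwa [Function.iterate_zero, id, ← h2] at h6
      · exact ⟨L, ⟨L, hL, by rw [trySplit_eq, if_neg hs]; simp⟩, hpath⟩
  exact this N₀ le_rfl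

/-! ### Stage 2 -/

theorem mem_step {a : List Bool} {S : State d} {L : Leaf d}
    (hL : L ∈ (step p rule M w a S).leaves) : L ∈ S.leaves ∨
      ∃ L₀ ∈ S.leaves, L ∈ trySplit p rule w (grow p M w L₀) := by
  classical
  unfold step at hL
  split at hL
  · exact Or.inl hL
  · rename_i L₀ h
    rw [List.mem_append, List.mem_filter, visit_snd] at hL
    rcases hL with hL | hL
    · exact Or.inl hL.1
    · exact Or.inr ⟨L₀, List.mem_of_find?_eq_some h, hL⟩

/-- Whichever leaf is selected, its visit count goes from `k` to `k + 1`, and it either stays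
unsplit or is replaced by nodes with count `0`. The strategy cannot leave the family of grown nodes.
-/
theorem isCurrent_step {a : List Bool} {S : State d}
    (hS : ∀ L ∈ S.leaves, IsCurrent p rule M N₀ w L) :
    ∀ L ∈ (step p rule M w a S).leaves, IsCurrent p rule M N₀ w L := by
  intro L hL
  rcases mem_step p rule M w hL with hL | ⟨L₀, hL₀, hL⟩
  · exact hS L hL
  · obtain ⟨h1, k, h2, h3⟩ := hS L₀ hL₀
    have h4 : grow p M w L₀ = (grow p M w)^[k + 1] (node p rule M N₀ w L₀.addr).leaf := by
      rw [Function.iterate_succ_apply', ← h2]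
    rw [h4] at hL
    rcases isCurrent_of_mem_trySplit p rule M N₀ w h1 (fun k' hk' => h3 k' (by omega))
      (Or.inr (by omega)) hL with ⟨h5, h6⟩ | ⟨b, h5, h6, h7, h8⟩
    · have h7 : L.addr = L₀.addr := by rw [h5, grow_addr, node_addr]
      unfold IsCurrent
      rw [h7]
      refine ⟨h1, k + 1, h5, fun k' hk' => ?_⟩
      rcases Nat.lt_or_ge k' (k + 1) with h | h
      · exact h3 k' (by omega)
      · rwa [show k' = k + 1 by omega]
    · unfold IsCurrent
      rw [h5]
      refine ⟨h6, 0, h7, fun k' hk' => ?_⟩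
      obtain rfl : k' = 0 := by omega
      -- The parent split at time `k + 1 ≠ 0`, so the child is not early and cannot split before its
      -- first visit.
      rintro ⟨h9, -⟩
      rw [h8] at h9
      simp at h9

theorem exists_onPath_step {x : Point d} {a : List Bool} {S : State d}
    (hS : ∀ L ∈ S.leaves, IsCurrent p rule M N₀ w L)
    (hx : ∃ L ∈ S.leaves, OnPath p rule M N₀ x w L.addr) :
    ∃ L ∈ (step p rule M w a S).leaves, OnPath p rule M N₀ x w L.addr := by
  classical
  obtain ⟨L, hL, hpath⟩ := hx
  unfold step
  split
  · exact ⟨L, hL, hpath⟩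
  · rename_i L₀ h
    have hL₀ := List.mem_of_find?_eq_some h
    have ha : L₀.addr = a := by simpa using List.find?_some h
    -- `find?` may a priori return another leaf with the same address; this is harmless, as being on
    -- the path is a property of the address.
    by_cases haL : L.addr = a
    · obtain ⟨h1, k, h2, h3⟩ := hS L₀ hL₀
      have h4 : grow p M w L₀ = (grow p M w)^[k + 1] (node p rule M N₀ w L₀.addr).leaf := by
        rw [Function.iterate_succ_apply', ← h2]
      rw [haL, ← ha] at hpath
      obtain ⟨L', h5, h6⟩ := exists_onPath_trySplit p rule M N₀ w hpath (k := k + 1)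
        (fun k' hk' => h3 k' (by omega)) (Or.inr (by omega))
      refine ⟨L', ?_, h6⟩
      rw [List.mem_append, visit_snd, h4]
      exact Or.inr h5
    · refine ⟨L, ?_, hpath⟩
      rw [List.mem_append, List.mem_filter]
      exact Or.inl ⟨hL, by simpa using haL⟩

theorem step_n_lt {a : List Bool} {S : State d} (ha : a ∈ S.leaves.map Leaf.addr) :
    S.n < (step p rule M w a S).n := by
  classical
  unfold step
  split
  · rename_i h
    rw [List.find?_eq_none] at h
    obtain ⟨L, hL, rfl⟩ := List.mem_map.1 ha
    exact absurd (h L hL) (by simp)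
  · have := visit_fst_pos p rule M w
    rename_i L _
    have := this L
    dsimp only
    omega

/-- The selected leaf is replaced by itself or by its two children, so it was at most one level
higher before. This compares the smallest depth after the step with the largest one before. -/
theorem exists_depth_le_step {a : List Bool} {S : State d} {c : ℕ} (hne : S.leaves ≠ [])
    (hc : ∀ L ∈ (step p rule M w a S).leaves, c + 1 ≤ L.depth) :
    ∃ L ∈ S.leaves, c ≤ L.depth := by
  classical
  by_cases h : S.leaves.find? (fun L => L.addr = a) = none
  · unfold step at hc
    rw [h] at hc
    obtain ⟨L, hL⟩ := List.exists_mem_of_ne_nil _ hne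
    exact ⟨L, hL, (Nat.le_succ c).trans (hc L hL)⟩
  · obtain ⟨L₀, h⟩ := Option.ne_none_iff_exists'.1 h
    refine ⟨L₀, List.mem_of_find?_eq_some h, ?_⟩
    unfold step at hc
    rw [h] at hc
    simp only [List.mem_append, visit_snd, trySplit_eq] at hc
    have hd : (grow p M w L₀).depth = L₀.depth := by
      have := grow_addr p M w L₀ 1
      simp only [Function.iterate_one] at this
      simp only [Leaf.depth, this]
    split_ifs at hc with h'
    · have := hc (child rule w (grow p M w L₀) false) (Or.inr (by simp))
      have h2 : (child rule w (grow p M w L₀) false).depth = (grow p M w L₀).depth + 1 := rfl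
      omega
    · have := hc (grow p M w L₀) (Or.inr (by simp))
      omega

/-! ### The loop -/

section Loop

variable {V : Type*} (strat : Strategy d V) (v : V)

/-- The `j`-th state of the search without a budget, with the list of the earlier states. -/
def orbit (j : ℕ) : State d × List (State d) :=
  (fun h : State d × List (State d) => (step p rule M w (strat v h.1 h.2) h.1, h.1 :: h.2))^[j]
    (stageOne p rule M w N₀, [])

theorem orbit_succ (j : ℕ) : orbit p rule M N₀ w strat v (j + 1) =
    (step p rule M w (strat v (orbit p rule M N₀ w strat v j).1 (orbit p rule M N₀ w strat v j).2)
      (orbit p rule M N₀ w strat v j).1,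
      (orbit p rule M N₀ w strat v j).1 :: (orbit p rule M N₀ w strat v j).2) := by
  unfold orbit
  rw [Function.iterate_succ_apply']

theorem isCurrent_orbit (j : ℕ) :
    ∀ L ∈ (orbit p rule M N₀ w strat v j).1.leaves, IsCurrent p rule M N₀ w L := by
  induction j with
  | zero => exact fun L hL => isCurrent_stageOne p rule M N₀ w hL
  | succ j ih =>
    rw [orbit_succ]
    exact isCurrent_step p rule M N₀ w ih

theorem exists_onPath_orbit (x : Point d) (j : ℕ) :
    ∃ L ∈ (orbit p rule M N₀ w strat v j).1.leaves, OnPath p rule M N₀ x w L.addr := by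
  induction j with
  | zero => exact exists_onPath_stageOne p rule M N₀ w x
  | succ j ih =>
    rw [orbit_succ]
    exact exists_onPath_step p rule M N₀ w (isCurrent_orbit p rule M N₀ w strat v j) ih

theorem orbit_leaves_ne_nil (j : ℕ) : (orbit p rule M N₀ w strat v j).1.leaves ≠ [] := by
  obtain ⟨L, hL, -⟩ := exists_onPath_orbit p rule M N₀ w strat v 0 j
  exact List.ne_nil_of_mem hL

variable {strat}

theorem orbit_n_strictMono (hstrat : strat.SelectsLeaf) :
    StrictMono fun j => (orbit p rule M N₀ w strat v j).1.n := by
  refine strictMono_nat_of_lt_succ fun j => ?_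
  rw [orbit_succ]
  exact step_n_lt p rule M w (hstrat _ _ _ (orbit_leaves_ne_nil p rule M N₀ w strat v j))

/-- The search with budget `N` stops at the first state with at least `N` simulation runs. -/
theorem finalLeaves_eq (hstrat : strat.SelectsLeaf) (N : ℕ) :
    ∃ j, finalLeaves p rule M strat N₀ w v N = (orbit p rule M N₀ w strat v j).1.leaves ∧
      N ≤ (orbit p rule M N₀ w strat v j).1.n ∧
      ∀ i < j, (orbit p rule M N₀ w strat v i).1.n < N := by
  have key : ∀ i, ∃ j ≤ i, (loopBody p rule M strat w v N)^[i] (stageOne p rule M w N₀, []) =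
      orbit p rule M N₀ w strat v j ∧ (j = i ∨ N ≤ (orbit p rule M N₀ w strat v j).1.n) ∧
      ∀ i' < j, (orbit p rule M N₀ w strat v i').1.n < N := by
    intro i
    induction i with
    | zero => exact ⟨0, le_rfl, rfl, Or.inl rfl, fun i' hi' => absurd hi' (by omega)⟩
    | succ i ih =>
      obtain ⟨j, h1, h2, h3, h4⟩ := ih
      rw [Function.iterate_succ_apply', h2]
      unfold loopBody
      split_ifs with h
      · obtain rfl := h3.resolve_right (by omega)
        refine ⟨j + 1, le_rfl, (orbit_succ p rule M N₀ w strat v j).symm, Or.inl rfl,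
          fun i' hi' => ?_⟩
        rcases Nat.lt_or_ge i' j with h' | h'
        · exact h4 i' h'
        · rwa [show i' = j by omega]
      · exact ⟨j, by omega, rfl, Or.inr (by omega), h4⟩
  obtain ⟨j, -, h2, h3, h4⟩ := key N
  refine ⟨j, by rw [finalLeaves, h2], ?_, h4⟩
  rcases h3 with rfl | h3
  -- All `N` passes were active; a strictly increasing sequence of naturals is at least its index,
  -- so the budget is exhausted.
  · exact (orbit_n_strictMono p rule M N₀ w v hstrat).le_apply
  · exact h3

/-- Every step uses at least one run, so budget `N + 1` allows at most one step more than budget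
`N`, and a step deepens a leaf by at most one level. -/
theorem exists_depth_le_finalLeaves (hstrat : strat.SelectsLeaf) {N c : ℕ}
    (hc : ∀ L ∈ finalLeaves p rule M strat N₀ w v (N + 1), c + 1 ≤ L.depth) :
    ∃ L ∈ finalLeaves p rule M strat N₀ w v N, c ≤ L.depth := by
  obtain ⟨j, h1, h2, h3⟩ := finalLeaves_eq p rule M N₀ w v hstrat N
  obtain ⟨j', h1', h2', h3'⟩ := finalLeaves_eq p rule M N₀ w v hstrat (N + 1)
  have hmono := orbit_n_strictMono p rule M N₀ w v hstrat
  rw [h1]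
  rw [h1'] at hc
  have hj : j ≤ j' := by
    by_contra hlt
    have := h3 j' (by omega)
    omega
  have hj' : j' ≤ j + 1 := by
    by_contra hlt
    have h4 := h3' (j + 1) (by omega)
    have h5 : (orbit p rule M N₀ w strat v j).1.n < (orbit p rule M N₀ w strat v (j + 1)).1.n :=
      hmono (Nat.lt_succ_self j)
    omega
  rcases Nat.lt_or_ge j j' with h | h
  · obtain rfl : j' = j + 1 := by omega
    rw [orbit_succ] at hc
    exact exists_depth_le_step p rule M w (orbit_leaves_ne_nil p rule M N₀ w strat v j) hc
  · obtain rfl : j = j' := by omega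
    obtain ⟨L, hL⟩ := List.exists_mem_of_ne_nil _ (orbit_leaves_ne_nil p rule M N₀ w strat v j)
    exact ⟨L, hL, (Nat.le_succ c).trans (hc L hL)⟩

theorem isCurrent_finalLeaves (hstrat : strat.SelectsLeaf) (N : ℕ) {L : Leaf d}
    (hL : L ∈ finalLeaves p rule M strat N₀ w v N) : IsCurrent p rule M N₀ w L := by
  obtain ⟨j, h1, -⟩ := finalLeaves_eq p rule M N₀ w v hstrat N
  exact isCurrent_orbit p rule M N₀ w strat v j L (h1 ▸ hL)

theorem exists_onPath_finalLeaves (hstrat : strat.SelectsLeaf) (N : ℕ) (x : Point d) :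
    ∃ L ∈ finalLeaves p rule M strat N₀ w v N, OnPath p rule M N₀ x w L.addr := by
  obtain ⟨j, h1, -⟩ := finalLeaves_eq p rule M N₀ w v hstrat N
  rw [h1]
  exact exists_onPath_orbit p rule M N₀ w strat v x j

end Loop

end Nodes

/-! ### Rectangles and sample counts of the nodes -/

section Geometry

set_option linter.unusedSectionVars false

variable {d : ℕ} {Ξ : Type*} [MeasurableSpace Ξ]

/-- The rectangle of the leaf lies in the unit cube and contains the `𝓘`-samples of the leaf. -/
structure Leaf.WellPlaced (L : Leaf d) : Prop where
  lo_nonneg : ∀ j, 0 ≤ L.lo j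
  lo_le_hi : ∀ j, L.lo j ≤ L.hi j
  hi_le_one : ∀ j, L.hi j ≤ 1
  lo_le : ∀ s ∈ L.dataI, ∀ j, L.lo j ≤ s.1 j
  le_hi : ∀ s ∈ L.dataI, ∀ j, s.1 j ≤ L.hi j

theorem Leaf.WellPlaced.mem_cube {L : Leaf d} (h : L.WellPlaced) {s : Point d × ℝ}
    (hs : s ∈ L.dataI) : s.1 ∈ cube d :=
  fun j => ⟨(h.lo_nonneg j).trans (h.lo_le s hs j), (h.le_hi s hs j).trans (h.hi_le_one j)⟩

theorem Leaf.WellPlaced.pointAt {L : Leaf d} (h : L.WellPlaced) {u : Point d} (hu : u ∈ cube d)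
    (j : Fin d) : L.lo j ≤ L.pointAt u j ∧ L.pointAt u j ≤ L.hi j := by
  have h1 := h.lo_le_hi j
  have h2 := hu j
  simp only [Leaf.pointAt]
  constructor
  · nlinarith [h2.1]
  · nlinarith [h2.2]

variable {p : Params} {rule : SplitRule d} {M : Model d Ξ} {N₀ : ℕ} {w : Inputs d Ξ}

theorem Leaf.WellPlaced.drawI {L : Leaf d} (h : L.WellPlaced)
    (hw : ∀ i, (w.draw i).1 ∈ cube d) : (drawI M w L).WellPlaced where
  lo_nonneg := h.lo_nonneg
  lo_le_hi := h.lo_le_hi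
  hi_le_one := h.hi_le_one
  lo_le s hs j := by
    simp only [RegularTreeSearch.drawI, List.mem_append, List.mem_singleton] at hs
    rcases hs with hs | rfl
    · exact h.lo_le s hs j
    · exact (h.pointAt (hw _) j).1
  le_hi s hs j := by
    simp only [RegularTreeSearch.drawI, List.mem_append, List.mem_singleton] at hs
    rcases hs with hs | rfl
    · exact h.le_hi s hs j
    · exact (h.pointAt (hw _) j).2

theorem Leaf.WellPlaced.drawJ {L : Leaf d} (h : L.WellPlaced) : (drawJ M w L).WellPlaced :=
  ⟨h.lo_nonneg, h.lo_le_hi, h.hi_le_one, h.lo_le, h.le_hi⟩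

theorem Leaf.WellPlaced.iterate_grow {L : Leaf d} (h : L.WellPlaced)
    (hw : ∀ i, (w.draw i).1 ∈ cube d) (k : ℕ) : ((grow p M w)^[k] L).WellPlaced :=
  iterate_grow_induction p M w (q := Leaf.WellPlaced) (fun _ h => h.drawI hw) (fun _ h => h.drawJ)
    h k

theorem Splits.lo_le_split (hp : p.Valid) {L : Leaf d} (hL : L.WellPlaced)
    (hs : Splits p rule w L) :
    L.lo (proposal rule w L).1 ≤ (proposal rule w L).2 ∧
      (proposal rule w L).2 ≤ L.hi (proposal rule w L).1 := by
  have h1 := hs.2.lower_le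
  have h2 := hs.2.le_upper
  have h3 := hL.lo_le_hi (proposal rule w L).1
  have h4 := hp.α_pos
  constructor <;> nlinarith

theorem Leaf.WellPlaced.child (hp : p.Valid) {L : Leaf d} (hL : L.WellPlaced)
    (hs : Splits p rule w L) (b : Bool) : (child rule w L b).WellPlaced := by
  classical
  obtain ⟨h1, h2⟩ := hs.lo_le_split hp hL
  cases b
  · refine ⟨hL.lo_nonneg, fun j => ?_, fun j => ?_, fun s hs j => ?_, fun s hs j => ?_⟩
    all_goals
      simp only [RegularTreeSearch.child, Leaf.left, Bool.false_eq_true, if_false,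
        Function.update_apply, lower, List.mem_filter, decide_eq_true_eq] at hs ⊢
    · split_ifs with h
      · subst h; exact h1
      · exact hL.lo_le_hi j
    · split_ifs with h
      · subst h; exact h2.trans (hL.hi_le_one _)
      · exact hL.hi_le_one j
    · exact hL.lo_le s hs.1 j
    · split_ifs with h
      · subst h; exact hs.2
      · exact hL.le_hi s hs.1 j
  · refine ⟨fun j => ?_, fun j => ?_, hL.hi_le_one, fun s hs j => ?_, fun s hs j => ?_⟩
    all_goals
      simp only [RegularTreeSearch.child, Leaf.right, if_true,
        Function.update_apply, upper, List.mem_filter, decide_eq_true_eq] at hs ⊢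
    · split_ifs with h
      · subst h; exact (hL.lo_nonneg _).trans h1
      · exact hL.lo_nonneg j
    · split_ifs with h
      · subst h; exact h2
      · exact hL.lo_le_hi j
    · split_ifs with h
      · subst h; exact hs.2.le
      · exact hL.lo_le s hs.1 j
    · exact hL.le_hi s hs.1 j

theorem stageOneRoot_wellPlaced (hw : ∀ i, (w.draw i).1 ∈ cube d) :
    (stageOneRoot M w N₀).WellPlaced := by
  refine iterate_induction (q := Leaf.WellPlaced) (f := drawJ M w) (fun _ h => h.drawJ)
    (iterate_induction (q := Leaf.WellPlaced) (f := drawI M w) (fun _ h => h.drawI hw) ?_ _) _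
  exact ⟨fun _ => le_rfl, fun _ => zero_le_one, fun _ => le_rfl,
    fun _ hs => absurd hs List.not_mem_nil, fun _ hs => absurd hs List.not_mem_nil⟩

theorem node_wellPlaced (hp : p.Valid) (hw : ∀ i, (w.draw i).1 ∈ cube d) :
    ∀ a : List Bool, (node p rule M N₀ w a).alive = true →
      (node p rule M N₀ w a).leaf.WellPlaced
  | [], _ => stageOneRoot_wellPlaced hw
  | b :: a, h => by
    obtain ⟨h1, h2⟩ := alive_cons p rule M N₀ w h
    exact ((node_wellPlaced hp hw a h1).iterate_grow hw _).child hp h2 b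

/-- The factor by which a coin guarantees that the sides in direction `j` shrink. -/
def shrink (α : ℝ) (j : Fin d) (coin : Bool × Fin d) : ℝ := if coin = (true, j) then 1 - α else 1

/-- A split in direction `j` leaves at most the fraction `1 - α` of side `j`, by spatial balance,
and this is at most the claimed factor for every coin. A split in another direction leaves the side
as it is, but then the coin did not force `j` and the factor is `1`. -/
theorem side_child_le (hp : p.Valid) {L : Leaf d} (hL : L.WellPlaced)
    (hs : Splits p rule w L) (b : Bool) (j : Fin d) :
    (child rule w L b).hi j - (child rule w L b).lo j ≤
      shrink p.α j (w.coin L.addr) * (L.hi j - L.lo j) := by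
  have h1 := hs.2.lower_le
  have h2 := hs.2.le_upper
  have h3 := hL.lo_le_hi j
  have h4 := hp.α_pos
  have h5 := hs.2.direction
  set s := proposal rule w L
  have key : s.1 = j ∨ shrink p.α j (w.coin L.addr) = 1 := by
    unfold shrink
    split_ifs with h
    · rw [h] at h5
      exact Or.inl (h5 rfl)
    · exact Or.inr rfl
  have hle : shrink p.α j (w.coin L.addr) ≥ 1 - p.α := by
    unfold shrink
    split_ifs <;> linarith
  have hmul : (1 - p.α) * (L.hi j - L.lo j) ≤
      shrink p.α j (w.coin L.addr) * (L.hi j - L.lo j) :=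
    mul_le_mul_of_nonneg_right hle (by linarith)
  by_cases hj : s.1 = j
  · rw [hj] at h1 h2
    refine le_trans ?_ hmul
    cases b
    · simp only [child, Leaf.left, Bool.false_eq_true, if_false]
      change Function.update L.hi s.1 s.2 j - L.lo j ≤ _
      rw [hj, Function.update_self]
      linarith
    · simp only [child, Leaf.right, if_true]
      change L.hi j - Function.update L.lo s.1 s.2 j ≤ _
      rw [hj, Function.update_self]
      linarith
  · rw [key.resolve_left hj, one_mul]
    cases b
    · simp only [child, Leaf.left, Bool.false_eq_true, if_false]
      change Function.update L.hi s.1 s.2 j - L.lo j ≤ _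
      rw [Function.update_of_ne (Ne.symm hj)]
    · simp only [child, Leaf.right, if_true]
      change L.hi j - Function.update L.lo s.1 s.2 j ≤ _
      rw [Function.update_of_ne (Ne.symm hj)]

theorem side_node_cons_le (hp : p.Valid) (hw : ∀ i, (w.draw i).1 ∈ cube d) {a : List Bool}
    {b : Bool} (h : (node p rule M N₀ w (b :: a)).alive = true) (j : Fin d) :
    (node p rule M N₀ w (b :: a)).leaf.hi j - (node p rule M N₀ w (b :: a)).leaf.lo j ≤
      shrink p.α j (w.coin a) *
        ((node p rule M N₀ w a).leaf.hi j - (node p rule M N₀ w a).leaf.lo j) := by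
  obtain ⟨h1, h2⟩ := alive_cons p rule M N₀ w h
  have := side_child_le hp ((node_wellPlaced hp hw a h1).iterate_grow hw _) h2 b j
  rwa [grow_addr, node_addr, grow_hi, grow_lo] at this

theorem mem_box_of_onPath {x : Point d} (hx : x ∈ cube d) :
    ∀ a : List Bool, OnPath p rule M N₀ x w a → ∀ j,
      (node p rule M N₀ w a).leaf.lo j ≤ x j ∧ x j ≤ (node p rule M N₀ w a).leaf.hi j
  | [], _, j => by
    have h1 : (stageOneRoot M w N₀).lo = fun _ => 0 :=
      iterate_induction (q := fun L : Leaf d => L.lo = fun _ => 0) (f := drawJ M w) (fun _ h => h)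
        (iterate_induction (q := fun L : Leaf d => L.lo = fun _ => 0) (f := drawI M w)
          (fun _ h => h) (x := emptyRoot d) rfl _) _
    have h2 : (stageOneRoot M w N₀).hi = fun _ => 1 :=
      iterate_induction (q := fun L : Leaf d => L.hi = fun _ => 1) (f := drawJ M w) (fun _ h => h)
        (iterate_induction (q := fun L : Leaf d => L.hi = fun _ => 1) (f := drawI M w)
          (fun _ h => h) (x := emptyRoot d) rfl _) _
    simp only [node, h1, h2]
    exact hx j
  | b :: a, h, j => by
    obtain ⟨h1, h2⟩ := h
    have ih := mem_box_of_onPath hx a h1 j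
    rw [← grow_lo p M w _ ((node p rule M N₀ w a).splitTime p rule M w),
      ← grow_hi p M w _ ((node p rule M N₀ w a).splitTime p rule M w)] at ih
    change ((node p rule M N₀ w a).last p rule M w).lo j ≤ x j ∧
      x j ≤ ((node p rule M N₀ w a).last p rule M w).hi j at ih
    simp only [node]
    set L := (node p rule M N₀ w a).last p rule M w
    cases b
    · have h3 : x (proposal rule w L).1 ≤ (proposal rule w L).2 := by simpa using h2
      simp only [child, Leaf.left, Bool.false_eq_true, if_false, Function.update_apply]
      refine ⟨ih.1, ?_⟩
      split_ifs with hj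
      · subst hj; exact h3
      · exact ih.2
    · have h3 : (proposal rule w L).2 < x (proposal rule w L).1 := by simpa using h2
      simp only [child, Leaf.right, if_true, Function.update_apply]
      refine ⟨?_, ih.2⟩
      split_ifs with hj
      · subst hj; exact h3.le
      · exact ih.1

/-- A child inherits exactly the 𝓘-samples that the admissibility condition of its parent counts.
The threshold is taken at the depth of the parent, one less than that of the node. -/
theorem length_dataI_node (a : List Bool) (b : Bool)
    (h : (node p rule M N₀ w (b :: a)).alive = true) :
    p.β * p.f a.length ≤ (node p rule M N₀ w (b :: a)).leaf.dataI.length := by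
  classical
  obtain ⟨-, h2⟩ := alive_cons p rule M N₀ w h
  have h3 := h2.2.count_lower
  have h4 := h2.2.count_upper
  have hd : ((node p rule M N₀ w a).last p rule M w).depth = a.length := by
    rw [Leaf.depth, last_addr]
  rw [hd] at h3 h4
  simp only [node]
  set L := (node p rule M N₀ w a).last p rule M w
  cases b
  · refine h3.trans (le_of_eq ?_)
    simp only [child, Leaf.left, Bool.false_eq_true, if_false, countLower, lower, List.filter_map,
      List.length_map, Function.comp_def]
  · refine h4.trans (le_of_eq ?_)
    simp only [child, Leaf.right, if_true, countUpper, upper, List.filter_map,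
      List.length_map, Function.comp_def]

end Geometry

/-! ### Measurability of the nodes -/

section Measurability

variable {d : ℕ} {Ξ : Type*} [MeasurableSpace Ξ] {Ω : Type*} [MeasurableSpace Ω]

/-- The σ-algebra on leaves that is generated by everything but the address. -/
instance Leaf.instMeasurableSpace : MeasurableSpace (Leaf d) :=
  MeasurableSpace.comap
    (fun L : Leaf d => ((L.lo, L.hi), (L.dataI, L.dataJ), (L.drawnI, L.drawnJ))) inferInstance

theorem measurable_leaf_iff {F : Ω → Leaf d} : Measurable F ↔
    ((Measurable fun w => (F w).lo) ∧ (Measurable fun w => (F w).hi)) ∧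
    ((Measurable fun w => (F w).dataI) ∧ (Measurable fun w => (F w).dataJ)) ∧
    ((Measurable fun w => (F w).drawnI) ∧ (Measurable fun w => (F w).drawnJ)) := by
  rw [Leaf.instMeasurableSpace, measurable_comap_iff]
  exact ⟨fun h => ⟨⟨h.fst.fst, h.fst.snd⟩, ⟨h.snd.fst.fst, h.snd.fst.snd⟩, h.snd.snd.fst,
    h.snd.snd.snd⟩, fun h => (h.1.1.prodMk h.1.2).prodMk
      ((h.2.1.1.prodMk h.2.1.2).prodMk (h.2.2.1.prodMk h.2.2.2))⟩

theorem measurable_pointAt {F : Ω → Leaf d} (hF : Measurable F) {u : Ω → Point d}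
    (hu : Measurable u) : Measurable fun w => (F w).pointAt (u w) := by
  obtain ⟨⟨h1, h2⟩, -⟩ := measurable_leaf_iff.1 hF
  unfold Leaf.pointAt
  fun_prop

theorem measurable_response (M : Model d Ξ) {x : Ω → Point d} {ξ : Ω → Ξ} (hx : Measurable x)
    (hξ : Measurable ξ) : Measurable fun w => M.response (x w) (ξ w) :=
  (M.measurable_μ.comp hx).add (M.measurable_noise.comp (hx.prodMk hξ))

/-- The draws and the coins are measurable. -/
structure MeasurableInputs (inp : Ω → Inputs d Ξ) : Prop where
  draw : ∀ i, Measurable fun ω => (inp ω).draw i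
  coin : ∀ a, Measurable fun ω => (inp ω).coin a

variable {p : Params} {rule : SplitRule d} {M : Model d Ξ} {N₀ : ℕ} {inp : Ω → Inputs d Ξ}

/-- Since the address is constant, only the running number of the draw is random, and the draw is
selected from a countable family. -/
theorem measurable_drawI (hi : MeasurableInputs inp) {F : Ω → Leaf d} (hF : Measurable F)
    {a : List Bool} (ha : ∀ w, (F w).addr = a) : Measurable fun w => drawI M (inp w) (F w) := by
  have hF' := hF
  obtain ⟨⟨h1, h2⟩, ⟨h3, h4⟩, h5, h6⟩ := measurable_leaf_iff.1 hF
  have hq : Measurable fun w => (inp w).draw ((F w).addr, true, (F w).drawnI) := by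
    simp only [ha]
    exact measurable_apply_countable (F := fun n w => (inp w).draw (a, true, n))
      (fun n => hi.draw _) h5
  refine measurable_leaf_iff.2 ⟨⟨h1, h2⟩, ⟨?_, h4⟩, h5.add_const 1, h6⟩
  have hx := measurable_pointAt hF hq.fst
  exact measurable_list_append_singleton (hx.prodMk (measurable_response M hx hq.snd)) h3

theorem measurable_drawJ (hi : MeasurableInputs inp) {F : Ω → Leaf d} (hF : Measurable F)
    {a : List Bool} (ha : ∀ w, (F w).addr = a) : Measurable fun w => drawJ M (inp w) (F w) := by
  obtain ⟨⟨h1, h2⟩, ⟨h3, h4⟩, h5, h6⟩ := measurable_leaf_iff.1 hF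
  have hq : Measurable fun w => (inp w).draw ((F w).addr, false, (F w).drawnJ) := by
    simp only [ha]
    exact measurable_apply_countable (F := fun n w => (inp w).draw (a, false, n))
      (fun n => hi.draw _) h6
  refine measurable_leaf_iff.2 ⟨⟨h1, h2⟩, ⟨h3, ?_⟩, h5, h6.add_const 1⟩
  have hx := measurable_pointAt hF hq.fst
  exact measurable_list_append_singleton (hx.prodMk (measurable_response M hx hq.snd)) h4

theorem measurable_iterate {f : Ω → Leaf d → Leaf d}
    (hf : ∀ (F : Ω → Leaf d) (a : List Bool), Measurable F → (∀ w, (F w).addr = a) →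
      Measurable fun w => f w (F w))
    (haddr : ∀ w L, (f w L).addr = L.addr) {F : Ω → Leaf d} (hF : Measurable F)
    {a : List Bool} (ha : ∀ w, (F w).addr = a) (n : ℕ) : Measurable fun w => (f w)^[n] (F w) := by
  induction n with
  | zero => exact hF
  | succ n ih =>
    simp only [Function.iterate_succ_apply']
    refine hf _ a ih fun w => ?_
    have := iterate_induction (q := fun L => L.addr = a) (f := f w)
      (fun L h => (haddr w L).trans h) (ha w) n
    exact this

theorem measurableSet_full {F : Ω → Leaf d} (hF : Measurable F)
    {a : List Bool} (ha : ∀ w, (F w).addr = a) : MeasurableSet {w | (F w).Full p} := by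
  obtain ⟨-, ⟨h3, -⟩, -⟩ := measurable_leaf_iff.1 hF
  simp only [Leaf.Full, Leaf.depth, ha]
  exact measurableSet_le measurable_const
    ((measurable_from_nat (f := fun n : ℕ => (n : ℝ))).comp (measurable_list_length h3))

theorem measurable_grow (hi : MeasurableInputs inp) {F : Ω → Leaf d} (hF : Measurable F)
    {a : List Bool} (ha : ∀ w, (F w).addr = a) :
    Measurable fun w => grow p M (inp w) (F w) := by
  classical
  have h1 := measurable_drawI (M := M) hi hF ha
  have h2 : ∀ w, (drawI M (inp w) (F w)).addr = a := ha
  unfold grow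
  refine Measurable.ite (measurableSet_full h1 h2) ?_ h1
  refine measurable_apply_countable (F := fun n w => (drawJ M (inp w))^[n] (drawI M (inp w) (F w)))
    (fun n => measurable_iterate (fun F a hF ha => measurable_drawJ hi hF ha) (fun _ _ => rfl)
      h1 h2 n) ?_
  simp only [missingJ, Leaf.depth, h2]
  obtain ⟨-, ⟨-, h4⟩, -⟩ := measurable_leaf_iff.1 h1
  exact (measurable_from_nat (f := fun n : ℕ => ⌈p.f a.length⌉₊ - n)).comp
    (measurable_list_length h4)

theorem measurable_iterate_grow (hi : MeasurableInputs inp) {F : Ω → Leaf d} (hF : Measurable F)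
    {a : List Bool} (ha : ∀ w, (F w).addr = a) (n : ℕ) :
    Measurable fun w => (grow p M (inp w))^[n] (F w) :=
  measurable_iterate (fun _ _ hF ha => measurable_grow hi hF ha)
    (fun w L => grow_addr p M (inp w) L 1) hF ha n

theorem measurable_proposal (hrule : IsSplitRule p rule) (hi : MeasurableInputs inp)
    {F : Ω → Leaf d} (hF : Measurable F) {a : List Bool} (ha : ∀ w, (F w).addr = a) :
    Measurable fun w => proposal rule (inp w) (F w) := by
  obtain ⟨⟨h1, h2⟩, ⟨h3, h4⟩, -⟩ := measurable_leaf_iff.1 hF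
  simp only [proposal, Leaf.depth, ha]
  refine measurable_apply_countable (F := fun c w => rule a.length c
    (splitInput (F w).lo (F w).hi ((F w).dataI.map Prod.fst) (F w).dataJ)) (fun c => ?_) (hi.coin a)
  refine (hrule.measurable a.length c).comp ((h1.prodMk h2).prodMk (Measurable.prodMk ?_ ?_))
  · exact measurable_list_get (measurable_list_map measurable_fst h3)
  · exact measurable_list_get h4

theorem measurable_coord : Measurable fun q : Point d × Fin d => q.1 q.2 :=
  measurable_apply_countable (F := fun (j : Fin d) (q : Point d × Fin d) => q.1 j)
    (fun j => by fun_prop) measurable_snd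

theorem measurable_apply_fin {G : Ω → Fin d → ℝ} (hG : Measurable G) {j : Ω → Fin d}
    (hj : Measurable j) : Measurable fun w => G w (j w) :=
  measurable_apply_countable (F := fun (j : Fin d) w => G w j) (fun j => by fun_prop) hj

/-- Admissibility is tested for the proposed split only. The event is therefore a finite
intersection of conditions on measurable functions, and no projection along all possible splits is
needed. -/
theorem measurableSet_splits (hrule : IsSplitRule p rule) (hi : MeasurableInputs inp)
    {F : Ω → Leaf d} (hF : Measurable F) {a : List Bool} (ha : ∀ w, (F w).addr = a) :
    MeasurableSet {w | Splits p rule (inp w) (F w)} := by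
  classical
  obtain ⟨⟨h1, h2⟩, ⟨h3, h4⟩, -⟩ := measurable_leaf_iff.1 hF
  have hs := measurable_proposal hrule hi hF ha
  have hX := measurable_list_map measurable_fst h3
  have heq : {w | Splits p rule (inp w) (F w)} = {w | (F w).Full p} ∩
      ({w | ((inp w).coin a).1 = true → (proposal rule (inp w) (F w)).1 = ((inp w).coin a).2} ∩
      ({w | (1 - p.α) * (F w).lo (proposal rule (inp w) (F w)).1 +
        p.α * (F w).hi (proposal rule (inp w) (F w)).1 ≤ (proposal rule (inp w) (F w)).2} ∩
      ({w | (proposal rule (inp w) (F w)).2 ≤ p.α * (F w).lo (proposal rule (inp w) (F w)).1 +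
        (1 - p.α) * (F w).hi (proposal rule (inp w) (F w)).1} ∩
      ({w | p.β * p.f a.length ≤ countLower ((F w).dataI.map Prod.fst)
          (proposal rule (inp w) (F w)).1 (proposal rule (inp w) (F w)).2} ∩
        {w | p.β * p.f a.length ≤ countUpper ((F w).dataI.map Prod.fst)
          (proposal rule (inp w) (F w)).1 (proposal rule (inp w) (F w)).2})))) := by
    ext w
    simp only [Splits, Leaf.depth, ha, Set.mem_ofPred_eq, Set.mem_inter_iff]
    refine and_congr_right fun _ => ⟨fun h => ⟨h.1, h.2, h.3, h.4, h.5⟩, fun h => ?_⟩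
    exact ⟨h.1, h.2.1, h.2.2.1, h.2.2.2.1, h.2.2.2.2⟩
  have hlo := measurable_apply_fin h1 hs.fst
  have hhi := measurable_apply_fin h2 hs.fst
  have hcast : Measurable fun n : ℕ => (n : ℝ) := measurable_from_nat
  rw [heq]
  refine (measurableSet_full hF ha).inter (MeasurableSet.inter ?_ (MeasurableSet.inter ?_
    (MeasurableSet.inter ?_ (MeasurableSet.inter ?_ ?_))))
  · have hc : Measurable fun w => ((inp w).coin a, (proposal rule (inp w) (F w)).1) :=
      (hi.coin a).prodMk hs.fst
    exact hc (Set.to_countable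
      {q : (Bool × Fin d) × Fin d | q.1.1 = true → q.2 = q.1.2}).measurableSet
  · exact measurableSet_le ((hlo.const_mul _).add (hhi.const_mul _)) hs.snd
  · exact measurableSet_le hs.snd ((hlo.const_mul _).add (hhi.const_mul _))
  · refine measurableSet_le measurable_const (hcast.comp (measurable_list_length ?_))
    exact measurable_list_filter (q := fun w (x : Point d) =>
      x (proposal rule (inp w) (F w)).1 ≤ (proposal rule (inp w) (F w)).2)
      (fun x hx => measurableSet_le (measurable_coord.comp (hx.prodMk hs.fst)) hs.snd) hX
  · refine measurableSet_le measurable_const (hcast.comp (measurable_list_length ?_))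
    exact measurable_list_filter (q := fun w (x : Point d) =>
      (proposal rule (inp w) (F w)).2 < x (proposal rule (inp w) (F w)).1)
      (fun x hx => measurableSet_lt hs.snd (measurable_coord.comp (hx.prodMk hs.fst))) hX

theorem measurable_update {G : Ω → Fin d → ℝ} (hG : Measurable G) {s : Ω → Fin d × ℝ}
    (hs : Measurable s) : Measurable fun w => Function.update (G w) (s w).1 (s w).2 := by
  refine measurable_pi_lambda _ fun i => ?_
  simp only [Function.update_apply]
  refine Measurable.ite ?_ hs.snd (by fun_prop)
  exact measurableSet_eq_fun measurable_const hs.fst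

theorem measurable_child (hrule : IsSplitRule p rule) (hi : MeasurableInputs inp)
    {F : Ω → Leaf d} (hF : Measurable F) {a : List Bool} (ha : ∀ w, (F w).addr = a) (b : Bool) :
    Measurable fun w => child rule (inp w) (F w) b := by
  classical
  obtain ⟨⟨h1, h2⟩, ⟨h3, h4⟩, -⟩ := measurable_leaf_iff.1 hF
  have hs := measurable_proposal hrule hi hF ha
  have hc : ∀ x : Ω → Point d × ℝ, Measurable x →
      Measurable fun w => (x w).1 (proposal rule (inp w) (F w)).1 :=
    fun x hx => measurable_coord.comp (hx.fst.prodMk hs.fst)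
  cases b
  · refine measurable_leaf_iff.2 ⟨⟨h1, measurable_update h2 hs⟩, ⟨?_, ?_⟩, measurable_const,
      measurable_const⟩
    · exact measurable_list_filter (q := fun w (x : Point d × ℝ) =>
        x.1 (proposal rule (inp w) (F w)).1 ≤ (proposal rule (inp w) (F w)).2)
        (fun x hx => measurableSet_le (hc x hx) hs.snd) h3
    · exact measurable_list_filter (q := fun w (x : Point d × ℝ) =>
        x.1 (proposal rule (inp w) (F w)).1 ≤ (proposal rule (inp w) (F w)).2)
        (fun x hx => measurableSet_le (hc x hx) hs.snd) h4
  · refine measurable_leaf_iff.2 ⟨⟨measurable_update h1 hs, h2⟩, ⟨?_, ?_⟩, measurable_const,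
      measurable_const⟩
    · exact measurable_list_filter (q := fun w (x : Point d × ℝ) =>
        (proposal rule (inp w) (F w)).2 < x.1 (proposal rule (inp w) (F w)).1)
        (fun x hx => measurableSet_lt hs.snd (hc x hx)) h3
    · exact measurable_list_filter (q := fun w (x : Point d × ℝ) =>
        (proposal rule (inp w) (F w)).2 < x.1 (proposal rule (inp w) (F w)).1)
        (fun x hx => measurableSet_lt hs.snd (hc x hx)) h4

/-- Measurability of a node with a fixed address. -/
structure MeasurableNode (a : List Bool) (V : Ω → Node d) : Prop where
  addr : ∀ w, (V w).leaf.addr = a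
  leaf : Measurable fun w => (V w).leaf
  early : Measurable fun w => (V w).early
  alive : Measurable fun w => (V w).alive

variable {a : List Bool} {V : Ω → Node d}

theorem MeasurableNode.measurableSet_splitsAt (hV : MeasurableNode a V)
    (hrule : IsSplitRule p rule) (hi : MeasurableInputs inp) (k : ℕ) :
    MeasurableSet {w | (V w).SplitsAt p rule M (inp w) k} := by
  have h1 : MeasurableSet {w | Splits p rule (inp w) ((grow p M (inp w))^[k] (V w).leaf)} :=
    measurableSet_splits hrule hi (measurable_iterate_grow hi hV.leaf hV.addr k)
      fun w => (grow_addr p M (inp w) _ k).trans (hV.addr w)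
  exact ((hV.early (measurableSet_singleton true)).union (MeasurableSet.const (k ≠ 0))).inter h1

theorem MeasurableNode.measurable_splitTime (hV : MeasurableNode a V)
    (hrule : IsSplitRule p rule) (hi : MeasurableInputs inp) :
    Measurable fun w => (V w).splitTime p rule M (inp w) := by
  classical
  have h1 := fun k => hV.measurableSet_splitsAt (M := M) hrule hi k
  refine measurable_to_countable' fun k => ?_
  -- The second set accounts for the default value: nodes that never split have split time `0`.
  have heq : (fun w => (V w).splitTime p rule M (inp w)) ⁻¹' {k} =
      ({w | (V w).SplitsAt p rule M (inp w) k} ∩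
        ⋂ k' : ℕ, ⋂ _ : k' < k, {w | (V w).SplitsAt p rule M (inp w) k'}ᶜ) ∪
      ({_w | k = 0} ∩ ⋂ k' : ℕ, {w | (V w).SplitsAt p rule M (inp w) k'}ᶜ) := by
    ext w
    simp only [Set.mem_preimage, Set.mem_singleton_iff, Set.mem_union, Set.mem_inter_iff,
      Set.mem_iInter, Set.mem_compl_iff, Set.mem_ofPred_eq]
    by_cases h : ∃ k, (V w).SplitsAt p rule M (inp w) k
    · rw [Node.splitTime, dif_pos h, Nat.find_eq_iff]
      obtain ⟨k', hk'⟩ := h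
      exact ⟨Or.inl, fun h => h.elim id fun h => absurd hk' (h.2 k')⟩
    · rw [Node.splitTime, dif_neg h]
      push Not at h
      exact ⟨fun h' => Or.inr ⟨h'.symm, h⟩, fun h' => h'.elim (fun h' => absurd h'.1 (h k))
        fun h' => h'.1.symm⟩
  rw [heq]
  refine ((h1 k).inter ?_).union ((MeasurableSet.const _).inter
    (MeasurableSet.iInter fun k' => (h1 k').compl))
  exact MeasurableSet.iInter fun k' => MeasurableSet.iInter fun _ => (h1 k').compl

theorem MeasurableNode.measurable_last (hV : MeasurableNode a V)
    (hrule : IsSplitRule p rule) (hi : MeasurableInputs inp) :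
    Measurable fun w => (V w).last p rule M (inp w) :=
  measurable_apply_countable (F := fun k w => (grow p M (inp w))^[k] (V w).leaf)
    (fun k => measurable_iterate_grow hi hV.leaf hV.addr k)
    (hV.measurable_splitTime (M := M) hrule hi)

theorem measurableNode_node (hrule : IsSplitRule p rule) (hi : MeasurableInputs inp) :
    ∀ a : List Bool, MeasurableNode a fun w => node p rule M N₀ (inp w) a
  | [] => by
    refine ⟨fun w => node_addr p rule M N₀ (inp w) [], ?_, measurable_const, measurable_const⟩
    have h1 : Measurable fun w => (drawI M (inp w))^[N₀ / 2] (emptyRoot d) :=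
      measurable_iterate (fun _ _ hF ha => measurable_drawI hi hF ha) (fun _ _ => rfl)
        measurable_const (a := []) (fun _ => rfl) _
    exact measurable_iterate (fun _ _ hF ha => measurable_drawJ hi hF ha) (fun _ _ => rfl)
        h1 (a := []) (fun w => iterate_induction (q := fun L : Leaf d => L.addr = [])
          (f := drawI M (inp w)) (fun _ h => h) (x := emptyRoot d) rfl _) _
  | b :: a => by
    classical
    have ih := measurableNode_node hrule hi a
    have hT := ih.measurable_splitTime (M := M) hrule hi
    refine ⟨fun w => node_addr p rule M N₀ (inp w) _, ?_, ?_, ?_⟩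
    · exact measurable_child hrule hi (ih.measurable_last (M := M) hrule hi)
        (fun w => last_addr p rule M N₀ (inp w) a) b
    · have h1 : Measurable fun q : Bool × ℕ =>
          q.1 && decide (q.2 = 0) && decide (a.length + 1 < N₀) := measurable_of_countable _
      exact h1.comp (ih.early.prodMk hT)
    · have h2 : MeasurableSet
          {w | ∃ k, (node p rule M N₀ (inp w) a).SplitsAt p rule M (inp w) k} := by
        rw [Set.ofPred_exists]
        exact MeasurableSet.iUnion fun k => ih.measurableSet_splitsAt (M := M) hrule hi k
      have h3 : Measurable fun w =>
          decide (∃ k, (node p rule M N₀ (inp w) a).SplitsAt p rule M (inp w) k) := by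
        refine measurable_to_bool ?_
        convert h2 using 1
        ext w
        simp
      have h1 : Measurable fun q : Bool × Bool => q.1 && q.2 := measurable_of_countable _
      exact h1.comp (ih.alive.prodMk h3)

theorem measurableSet_onPath (hrule : IsSplitRule p rule) (hi : MeasurableInputs inp)
    (x : Point d) : ∀ a : List Bool, MeasurableSet {w | OnPath p rule M N₀ x (inp w) a}
  | [] => MeasurableSet.univ
  | b :: a => by
    have ih := measurableSet_onPath hrule hi x a
    have hV := measurableNode_node (M := M) (N₀ := N₀) hrule hi a
    have hs := measurable_proposal hrule hi (hV.measurable_last (M := M) hrule hi)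
      (fun w => last_addr p rule M N₀ (inp w) a)
    have h1 := measurableSet_lt hs.snd (measurable_coord.comp (measurable_const.prodMk hs.fst) :
      Measurable fun w =>
        x (proposal rule (inp w) ((node p rule M N₀ (inp w) a).last p rule M (inp w))).1)
    refine ih.inter ?_
    cases b
    · refine h1.compl.congr (Set.ext fun w => ?_)
      exact ⟨fun h => ⟨fun h' => absurd h' Bool.false_ne_true, fun h' => absurd h' h⟩,
        fun h h' => Bool.false_ne_true (h.2 h')⟩
    · refine h1.congr (Set.ext fun w => ?_)
      exact ⟨fun h => ⟨fun _ => h, fun _ => rfl⟩, fun h => h.1 rfl⟩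

end Measurability

/-! ### Honesty: the tree does not depend on the noise of the `𝓘`-samples -/

section Honesty

set_option linter.unusedSectionVars false

variable {d : ℕ} {Ξ : Type*} [MeasurableSpace Ξ]

/-- Replace the simulation inputs of the `𝓘`-samples by `ξ`. -/
def withNoise (s : Inputs d Ξ) (ξ : List Bool × Bool × ℕ → Ξ) : Inputs d Ξ where
  draw i := if i.2.1 = true then ((s.draw i).1, ξ i) else s.draw i
  coin := s.coin

/-- A leaf that depends on the simulation inputs `ξ` only through the responses of its `𝓘`-samples,
which are pairwise different draws. -/
def IsSkeleton (M : Model d Ξ) (F : (List Bool × Bool × ℕ → Ξ) → Leaf d) : Prop :=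
  ∃ (a : List Bool) (lo hi : Fin d → ℝ) (l : List (Point d × (List Bool × Bool × ℕ)))
    (DJ : List (Point d × ℝ)) (nI nJ : ℕ), (l.map Prod.snd).Nodup ∧
    -- This guarantees that the next 𝓘-draw, with index `(a, true, nI)`, is new: earlier draws have
    -- another address or a smaller number. The bound on the lengths makes the address of a child
    -- new as well.
    (∀ q ∈ l, q.2.1.length ≤ a.length ∧ (q.2.1 = a → q.2.2.2 < nI)) ∧
    ∀ ξ, F ξ = ⟨a, lo, hi, l.map fun q => (q.1, M.response q.1 (ξ q.2)), DJ, nI, nJ⟩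

variable {p : Params} {rule : SplitRule d} {M : Model d Ξ} {N₀ : ℕ} {s : Inputs d Ξ}
  {F : (List Bool × Bool × ℕ → Ξ) → Leaf d}

theorem IsSkeleton.drawI (hF : IsSkeleton M F) :
    IsSkeleton M fun ξ => drawI M (withNoise s ξ) (F ξ) := by
  obtain ⟨a, lo, hi, l, DJ, nI, nJ, h1, h2, h3⟩ := hF
  set x := (Leaf.mk a lo hi [] DJ nI nJ).pointAt (s.draw (a, true, nI)).1
  refine ⟨a, lo, hi, l ++ [(x, (a, true, nI))], DJ, nI + 1, nJ, ?_, ?_, fun ξ => ?_⟩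
  · rw [List.map_append, List.nodup_append]
    refine ⟨h1, by simp, ?_⟩
    intro i hi j hj
    simp only [List.map_cons, List.map_nil, List.mem_singleton] at hj
    obtain ⟨q, hq, rfl⟩ := List.mem_map.1 hi
    rintro rfl
    have := (h2 q hq).2 (by rw [hj])
    rw [hj] at this
    exact lt_irrefl _ this
  · intro q hq
    rw [List.mem_append, List.mem_singleton] at hq
    rcases hq with hq | rfl
    · exact ⟨(h2 q hq).1, fun h => ((h2 q hq).2 h).trans (Nat.lt_succ_self _)⟩
    · exact ⟨le_rfl, fun _ => Nat.lt_succ_self _⟩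
  · dsimp only
    rw [h3]
    simp only [RegularTreeSearch.drawI, withNoise, if_true, List.map_append, List.map_cons,
      List.map_nil]
    rfl

theorem IsSkeleton.drawJ (hF : IsSkeleton M F) :
    IsSkeleton M fun ξ => drawJ M (withNoise s ξ) (F ξ) := by
  obtain ⟨a, lo, hi, l, DJ, nI, nJ, h1, h2, h3⟩ := hF
  set L : Leaf d := ⟨a, lo, hi, [], DJ, nI, nJ⟩
  refine ⟨a, lo, hi, l, DJ ++ [(L.pointAt (s.draw (a, false, nJ)).1,
    M.response (L.pointAt (s.draw (a, false, nJ)).1) (s.draw (a, false, nJ)).2)], nI, nJ + 1, h1, h2,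
    fun ξ => ?_⟩
  dsimp only
  rw [h3]
  rfl

theorem IsSkeleton.iterate {f : (List Bool × Bool × ℕ → Ξ) → Leaf d → Leaf d}
    (hf : ∀ F, IsSkeleton M F → IsSkeleton M fun ξ => f ξ (F ξ)) (hF : IsSkeleton M F) (n : ℕ) :
    IsSkeleton M fun ξ => (f ξ)^[n] (F ξ) := by
  induction n with
  | zero => exact hF
  | succ n ih =>
    simp only [Function.iterate_succ_apply']
    exact hf _ ih

theorem IsSkeleton.full_iff (hF : IsSkeleton M F) (ξ ξ' : List Bool × Bool × ℕ → Ξ) :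
    (F ξ).Full p ↔ (F ξ').Full p := by
  obtain ⟨a, lo, hi, l, DJ, nI, nJ, h1, h2, h3⟩ := hF
  simp only [h3, Leaf.Full, Leaf.depth, List.length_map]

theorem IsSkeleton.missingJ_eq (hF : IsSkeleton M F) (ξ ξ' : List Bool × Bool × ℕ → Ξ) :
    missingJ p (F ξ) = missingJ p (F ξ') := by
  obtain ⟨a, lo, hi, l, DJ, nI, nJ, h1, h2, h3⟩ := hF
  simp only [h3, missingJ, Leaf.depth]

/-- This is honesty: the criterion receives the 𝓘-samples stripped of their responses, and
resampling changes neither the 𝓙-samples nor the coins. -/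
theorem IsSkeleton.proposal_eq (hF : IsSkeleton M F) (ξ ξ' : List Bool × Bool × ℕ → Ξ) :
    proposal rule (withNoise s ξ) (F ξ) = proposal rule (withNoise s ξ') (F ξ') := by
  obtain ⟨a, lo, hi, l, DJ, nI, nJ, h1, h2, h3⟩ := hF
  simp only [h3, proposal, Leaf.depth, withNoise, List.map_map, Function.comp_def]

theorem IsSkeleton.splits_iff (hF : IsSkeleton M F) (ξ ξ' : List Bool × Bool × ℕ → Ξ) :
    Splits p rule (withNoise s ξ) (F ξ) ↔ Splits p rule (withNoise s ξ') (F ξ') := by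
  unfold Splits
  rw [hF.full_iff ξ ξ', hF.proposal_eq ξ ξ']
  obtain ⟨a, lo, hi, l, DJ, nI, nJ, h1, h2, h3⟩ := hF
  simp only [h3, Leaf.depth, withNoise, List.map_map, Function.comp_def]

theorem IsSkeleton.grow (hF : IsSkeleton M F) :
    IsSkeleton M fun ξ => grow p M (withNoise s ξ) (F ξ) := by
  classical
  have h1 : IsSkeleton M fun ξ => RegularTreeSearch.drawI M (withNoise s ξ) (F ξ) := hF.drawI
  -- A reference `ξ₀` is needed to make the choices that do not depend on `ξ`; if there is no `ξ` at
  -- all, the claim is vacuous.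
  rcases isEmpty_or_nonempty (List Bool × Bool × ℕ → Ξ) with hE | ⟨⟨ξ₀⟩⟩
  · obtain ⟨a, lo, hi, l, DJ, nI, nJ, h1, h2, h3⟩ := hF
    exact ⟨a, lo, hi, l, DJ, nI, nJ, h1, h2, fun ξ => hE.elim ξ⟩
  unfold RegularTreeSearch.grow
  by_cases h : (RegularTreeSearch.drawI M (withNoise s ξ₀) (F ξ₀)).Full p
  · have h' : ∀ ξ, (RegularTreeSearch.drawI M (withNoise s ξ) (F ξ)).Full p :=
      fun ξ => (h1.full_iff ξ ξ₀).2 h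
    simp only [h', if_true, h1.missingJ_eq _ ξ₀]
    exact h1.iterate (f := fun ξ => RegularTreeSearch.drawJ M (withNoise s ξ))
      (fun _ hF => hF.drawJ) _
  · have h' : ∀ ξ, ¬ (RegularTreeSearch.drawI M (withNoise s ξ) (F ξ)).Full p :=
      fun ξ h'' => h ((h1.full_iff ξ₀ ξ).2 h'')
    simp only [h', if_false]
    exact h1

theorem IsSkeleton.iterate_grow (hF : IsSkeleton M F) (n : ℕ) :
    IsSkeleton M fun ξ => (RegularTreeSearch.grow p M (withNoise s ξ))^[n] (F ξ) :=
  hF.iterate (f := fun ξ => RegularTreeSearch.grow p M (withNoise s ξ)) (fun _ hF => hF.grow) n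

theorem IsSkeleton.child (hF : IsSkeleton M F) (b : Bool) :
    IsSkeleton M fun ξ => child rule (withNoise s ξ) (F ξ) b := by
  classical
  have hprop := hF.proposal_eq (rule := rule) (s := s)
  obtain ⟨a, lo, hi, l, DJ, nI, nJ, h1, h2, h3⟩ := hF
  rcases isEmpty_or_nonempty (List Bool × Bool × ℕ → Ξ) with hE | ⟨⟨ξ₀⟩⟩
  · exact ⟨a, lo, hi, l, DJ, nI, nJ, h1, h2, fun ξ => hE.elim ξ⟩
  set t := proposal rule (withNoise s ξ₀) (F ξ₀)
  -- The address of a child is longer than all addresses used so far, so its counter may restart at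
  -- `0`.
  have h2' : ∀ c, ∀ q ∈ l, q.2.1.length ≤ (c :: a).length ∧ (q.2.1 = c :: a → q.2.2.2 < 0) := by
    intro c q hq
    have := (h2 q hq).1
    refine ⟨this.trans (by simp), fun h => ?_⟩
    rw [h] at this
    simp at this
  cases b
  · refine ⟨false :: a, lo, Function.update hi t.1 t.2, l.filter fun q => q.1 t.1 ≤ t.2,
      lower t.1 t.2 DJ, 0, 0, ?_, fun q hq => h2' _ q (List.mem_filter.1 hq).1, fun ξ => ?_⟩
    · exact h1.sublist (List.filter_sublist.map _)
    · have h4 : RegularTreeSearch.child rule (withNoise s ξ) (F ξ) false = (F ξ).left t.1 t.2 := by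
        rw [RegularTreeSearch.child, hprop ξ ξ₀, if_neg Bool.false_ne_true]
      dsimp only
      rw [h4, h3]
      simp only [Leaf.left, lower, List.filter_map, Function.comp_def]
  · refine ⟨true :: a, Function.update lo t.1 t.2, hi, l.filter fun q => t.2 < q.1 t.1,
      upper t.1 t.2 DJ, 0, 0, ?_, fun q hq => h2' _ q (List.mem_filter.1 hq).1, fun ξ => ?_⟩
    · exact h1.sublist (List.filter_sublist.map _)
    · have h4 : RegularTreeSearch.child rule (withNoise s ξ) (F ξ) true = (F ξ).right t.1 t.2 := by
        rw [RegularTreeSearch.child, hprop ξ ξ₀, if_pos rfl]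
      dsimp only
      rw [h4, h3]
      simp only [Leaf.right, upper, List.filter_map, Function.comp_def]

theorem IsSkeleton.splitsAt_iff {V : (List Bool × Bool × ℕ → Ξ) → Node d}
    (hV : IsSkeleton M fun ξ => (V ξ).leaf) (hearly : ∀ ξ ξ', (V ξ).early = (V ξ').early)
    (ξ ξ' : List Bool × Bool × ℕ → Ξ) (k : ℕ) :
    ((V ξ).SplitsAt p rule M (withNoise s ξ) k ↔ (V ξ').SplitsAt p rule M (withNoise s ξ') k) := by
  unfold Node.SplitsAt
  rw [hearly ξ ξ', (hV.iterate_grow k).splits_iff ξ ξ']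

/-- The noise of the `𝓘`-samples does not influence the shape of a node. -/
theorem isSkeleton_node : ∀ a : List Bool,
    (IsSkeleton M fun ξ => (node p rule M N₀ (withNoise s ξ) a).leaf) ∧
    (∀ ξ ξ', (node p rule M N₀ (withNoise s ξ) a).early =
      (node p rule M N₀ (withNoise s ξ') a).early) ∧
    ∀ ξ ξ', (node p rule M N₀ (withNoise s ξ) a).alive =
      (node p rule M N₀ (withNoise s ξ') a).alive
  | [] => by
    refine ⟨?_, fun _ _ => rfl, fun _ _ => rfl⟩
    refine IsSkeleton.iterate (f := fun ξ => RegularTreeSearch.drawJ M (withNoise s ξ))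
      (fun _ hF => hF.drawJ) (IsSkeleton.iterate
        (f := fun ξ => RegularTreeSearch.drawI M (withNoise s ξ)) (fun _ hF => hF.drawI) ?_ _) _
    exact ⟨[], _, _, [], [], 0, 0, by simp, by simp, fun ξ => rfl⟩
  | b :: a => by
    classical
    obtain ⟨h1, h2, h3⟩ := isSkeleton_node a
    have hs : ∀ ξ ξ' k, _ ↔ _ := fun ξ ξ' k => h1.splitsAt_iff (p := p) (rule := rule) (s := s)
      (V := fun ξ => node p rule M N₀ (withNoise s ξ) a) h2 ξ ξ' k
    have ht : ∀ ξ ξ', (node p rule M N₀ (withNoise s ξ) a).splitTime p rule M (withNoise s ξ) =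
        (node p rule M N₀ (withNoise s ξ') a).splitTime p rule M (withNoise s ξ') :=
      fun ξ ξ' => splitTime_congr p rule M (hs ξ ξ')
    refine ⟨?_, fun ξ ξ' => ?_, fun ξ ξ' => ?_⟩
    · rcases isEmpty_or_nonempty (List Bool × Bool × ℕ → Ξ) with hE | ⟨⟨ξ₀⟩⟩
      · exact ⟨[], 0, 0, [], [], 0, 0, by simp, by simp, fun ξ => hE.elim ξ⟩
      · simp only [node, Node.last, ht _ ξ₀]
        exact (h1.iterate_grow _).child b
    · simp only [node, h2 ξ ξ', ht ξ ξ']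
    · simp only [node, h3 ξ ξ', hs ξ ξ']

/-- The sum of the deviations of the responses of the `𝓘`-samples from their means. -/
def deviation (M : Model d Ξ) (L : Leaf d) : ℝ := (L.dataI.map fun q => q.2 - M.μ q.1).sum

/-- The inputs for which the node with address `a` can be created and has a large average deviation
after `k` visits. -/
def noisy (p : Params) (rule : SplitRule d) (M : Model d Ξ) (N₀ : ℕ) (δ : ℝ) (a : List Bool)
    (k : ℕ) : Set (Inputs d Ξ) :=
  {w | (∀ i, (w.draw i).1 ∈ cube d) ∧ (node p rule M N₀ w a).alive = true ∧
    δ * ((grow p M w)^[k] (node p rule M N₀ w a).leaf).dataI.length ≤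
      |deviation M ((grow p M w)^[k] (node p rule M N₀ w a).leaf)|}

/-- With all inputs but the 𝓘-noise frozen at `s`, the leaf has fixed 𝓘-points, and its noises come
from different coordinates of `ξ`. Hoeffding applies, with at least `β f(a.length)` inherited
samples and one more for each of the `k` visits. -/
theorem measure_withNoise_noisy_le (hp : p.Valid) {c : ℝ≥0} (hc : 0 < c)
    (hsub : ∀ x ∈ cube d, HasSubgaussianMGF (M.noise x) c M.ρ) {δ : ℝ} (hδ : 0 < δ)
    (a : List Bool) (b : Bool) (k : ℕ) (s : Inputs d Ξ) :
    have := M.isProbabilityMeasure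
    Measure.infinitePi (fun _ : List Bool × Bool × ℕ => M.ρ)
      {ξ | withNoise s ξ ∈ noisy p rule M N₀ δ (b :: a) k} ≤
      ENNReal.ofReal (2 * Real.exp (-(δ ^ 2 / (2 * c)) * (p.β * p.f a.length + k))) := by
  have := M.isProbabilityMeasure
  intro _
  -- If the event occurs for some `ξ₀`, this one outcome supplies the sample count and the location
  -- in the cube for all `ξ`, since number and positions of the 𝓘-samples do not depend on `ξ`.
  rcases Set.eq_empty_or_nonempty {ξ | withNoise s ξ ∈ noisy p rule M N₀ δ (b :: a) k} with
    h | ⟨ξ₀, hcube, halive, -⟩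
  · rw [h]; simp
  obtain ⟨hleaf, -, halive'⟩ := isSkeleton_node (p := p) (rule := rule) (M := M) (N₀ := N₀) (s := s)
    (b :: a)
  have hwp := (node_wellPlaced hp hcube _ halive).iterate_grow (p := p) (M := M) hcube k
  have hlen0 := length_dataI_grow p M (withNoise s ξ₀)
    (node p rule M N₀ (withNoise s ξ₀) (b :: a)).leaf k
  have hlen1 := length_dataI_node a b halive
  obtain ⟨a', lo, hi, l, DJ, nI, nJ, h1, h2, h3⟩ := hleaf.iterate_grow (p := p) (s := s) k
  have hlen : p.β * p.f a.length + k ≤ l.length := by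
    have h4 := congrArg (fun L : Leaf d => L.dataI.length) (h3 ξ₀)
    simp only [List.length_map] at h4
    rw [← h4, hlen0]
    push_cast
    linarith
  have hpos : 0 < p.β * p.f a.length := mul_pos hp.β_pos (hp.f_pos _)
  have hne : l ≠ [] := by
    rintro rfl
    simp only [List.length_nil, Nat.cast_zero] at hlen
    have : (0 : ℝ) ≤ k := Nat.cast_nonneg _
    linarith
  have hcubel : ∀ q ∈ l, q.1 ∈ cube d := by
    intro q hq
    have : (q.1, M.response q.1 (ξ₀ q.2)) ∈
        ((grow p M (withNoise s ξ₀))^[k]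
          (node p rule M N₀ (withNoise s ξ₀) (b :: a)).leaf).dataI := by
      have h4 := congrArg Leaf.dataI (h3 ξ₀)
      dsimp only at h4
      rw [h4]
      exact List.mem_map.2 ⟨q, hq, rfl⟩
    exact hwp.mem_cube this
  have key := measure_list_sum_ge_le M.ρ M.noise
    (fun x => M.measurable_noise.comp measurable_prodMk_left) hc l h1
    (fun q hq => hsub _ (hcubel q hq)) hδ hne
  refine (measure_mono fun ξ hξ => ?_).trans (key.trans ?_)
  · have h4 := hξ.2.2
    have h5 := congrArg Leaf.dataI (h3 ξ)
    dsimp only at h5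
    rw [deviation, h5] at h4
    simpa [Model.response, Function.comp_def] using h4
  · refine ENNReal.ofReal_le_ofReal (mul_le_mul_of_nonneg_left (Real.exp_le_exp.2 ?_) zero_le_two)
    refine mul_le_mul_of_nonpos_left hlen ?_
    have : 0 ≤ δ ^ 2 / (2 * (c : ℝ)) := by positivity
    linarith

end Honesty

/-! ### The law of the inputs -/

section Law

set_option linter.unusedSectionVars false

/-- Integration with respect to a product measure whose first factor is resampled. -/
theorem lintegral_prod_resample {A C X : Type*} [MeasurableSpace A] [MeasurableSpace C]
    [MeasurableSpace X] (Q : Measure A) (R : Measure C) (S : Measure X) [SFinite Q] [SFinite R]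
    [SFinite S] {mix : A × X → A} (hmix : MeasurePreserving mix (Q.prod S) Q)
    {g : A × C → ℝ≥0∞} (hg : Measurable g) :
    ∫⁻ z, g z ∂(Q.prod R) = ∫⁻ z, ∫⁻ x, g (mix (z.1, x), z.2) ∂S ∂(Q.prod R) := by
  have hm := hmix.measurable
  have h1 : Measurable fun z : (A × C) × X => g (mix (z.1.1, z.2), z.1.2) := by fun_prop
  rw [lintegral_prod_symm _ hg.aemeasurable,
    lintegral_prod_symm _ (Measurable.lintegral_prod_right' h1).aemeasurable]
  refine lintegral_congr fun c => ?_
  have h2 : Measurable fun a => g (a, c) := by fun_prop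
  rw [← hmix.map_eq, lintegral_map h2 hm, hmix.map_eq]
  exact lintegral_prod _ (h2.comp hm).aemeasurable

variable {d : ℕ} {Ξ : Type*} [MeasurableSpace Ξ] {Ω : Type*} [MeasurableSpace Ω]
  {P : Measure Ω} [IsProbabilityMeasure P] {ρ : Measure Ξ} [IsProbabilityMeasure ρ] {κ : ℝ}
  {inp : Ω → Inputs d Ξ}

theorem IsInputs.measurable (hinp : IsInputs ρ κ P inp) :
    Measurable fun ω => ((inp ω).draw, (inp ω).coin) :=
  (measurable_pi_lambda _ hinp.measurable_draw).prodMk (measurable_pi_lambda _ hinp.measurable_coin)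

/-- The total mass is read off from the law of a single draw, so the volume of the Euclidean cube
need not be computed. -/
theorem IsInputs.isProbabilityMeasure_cube (hinp : IsInputs ρ κ P inp) :
    IsProbabilityMeasure (volume.restrict (cube d)) := by
  have h1 := Measure.isProbabilityMeasure_map (μ := P)
    (hinp.measurable_draw ([], true, 0)).aemeasurable
  rw [hinp.law_draw] at h1
  have h2 := h1.measure_univ
  rw [← Set.univ_prod_univ, Measure.prod_prod, measure_univ (μ := ρ), mul_one] at h2
  exact ⟨h2⟩

theorem IsInputs.map_eq (hinp : IsInputs ρ κ P inp) :
    P.map (fun ω => ((inp ω).draw, (inp ω).coin)) =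
      (P.map fun ω => (inp ω).draw).prod (P.map fun ω => (inp ω).coin) :=
  (indepFun_iff_map_prod_eq_prod_map_map
    (measurable_pi_lambda _ hinp.measurable_draw).aemeasurable
    (measurable_pi_lambda _ hinp.measurable_coin).aemeasurable).1 hinp.indep

theorem measurableSet_cube : MeasurableSet (cube d) := by
  have : cube d = ⋂ j, {x : Point d | x j ∈ Set.Icc (0 : ℝ) 1} := by
    ext x
    simp [cube]
  rw [this]
  exact MeasurableSet.iInter fun j => (by fun_prop : Measurable fun x : Point d => x j)
    measurableSet_Icc

theorem IsInputs.ae_cube (hinp : IsInputs ρ κ P inp) :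
    ∀ᵐ ω ∂P, ∀ i, ((inp ω).draw i).1 ∈ cube d := by
  rw [ae_all_iff]
  intro i
  have := hinp.isProbabilityMeasure_cube
  have h1 : P.map (fun ω => ((inp ω).draw i).1) = volume.restrict (cube d) := by
    refine (Measure.map_map measurable_fst (hinp.measurable_draw i)).symm.trans ?_
    rw [hinp.law_draw, Measure.map_fst_prod, measure_univ, one_smul]
  have h2 : ∀ᵐ x ∂(P.map (fun ω => ((inp ω).draw i).1)), x ∈ cube d := by
    rw [h1]
    exact ae_restrict_mem measurableSet_cube
  exact ae_of_ae_map (hinp.measurable_draw i).fst.aemeasurable h2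

/-- The noise of the `𝓘`-samples may be resampled. -/
theorem IsInputs.lintegral_withNoise (hinp : IsInputs ρ κ P inp) {g : Inputs d Ξ → ℝ≥0∞}
    (hg : Measurable fun z : (List Bool × Bool × ℕ → Point d × Ξ) × (List Bool → Bool × Fin d) =>
      g ⟨z.1, z.2⟩) :
    ∫⁻ ω, g (inp ω) ∂P = ∫⁻ ω, ∫⁻ ξ, g (withNoise (inp ω) ξ)
      ∂(Measure.infinitePi fun _ : List Bool × Bool × ℕ => ρ) ∂P := by
  have := hinp.isProbabilityMeasure_cube
  set U := volume.restrict (cube d)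
  set R' := Measure.infinitePi fun _ : List Bool × Bool × ℕ => ρ
  -- `withNoise`, coordinate by coordinate. Position and noise of one draw are independent, so
  -- exchanging the noise for an independent copy keeps the law `U.prod ρ`.
  set φ : List Bool × Bool × ℕ → (Point d × Ξ) × Ξ → Point d × Ξ :=
    fun i z => if i.2.1 = true then (z.1.1, z.2) else z.1
  have hφ : ∀ i, Measurable (φ i) := by
    intro i
    by_cases h : i.2.1 = true <;> simp only [φ, h, if_true, if_false, Bool.false_eq_true] <;>
      fun_prop
  have hlaw : P.map (fun ω => (inp ω).draw) = Measure.infinitePi fun _ => U.prod ρ := by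
    have := hinp.indep_draw.map_fun_eq_infinitePi_map hinp.measurable_draw
    simp only [hinp.law_draw] at this
    exact this
  have hmix : MeasurePreserving
      (fun z : (List Bool × Bool × ℕ → Point d × Ξ) × (List Bool × Bool × ℕ → Ξ) =>
        fun i => φ i (z.1 i, z.2 i))
      ((P.map fun ω => (inp ω).draw).prod R') (P.map fun ω => (inp ω).draw) := by
    refine ⟨measurable_pi_lambda _ fun i => (hφ i).comp (by fun_prop), ?_⟩
    rw [hlaw]
    refine map_infinitePi_prod_infinitePi _ _ _ φ hφ fun i => ?_
    by_cases h : i.2.1 = true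
    · simp only [φ, h, if_true]
      have := (measurePreserving_fst (μ := U) (ν := ρ)).prod (MeasurePreserving.id ρ)
      exact this.map_eq
    · simp only [φ, h]
      exact (measurePreserving_fst (μ := U.prod ρ) (ν := ρ)).map_eq
  have hprobC := Measure.isProbabilityMeasure_map (μ := P)
    (measurable_pi_lambda (fun ω => (inp ω).coin) hinp.measurable_coin).aemeasurable
  have hprobD := Measure.isProbabilityMeasure_map (μ := P)
    (measurable_pi_lambda (fun ω => (inp ω).draw) hinp.measurable_draw).aemeasurable
  have h1 := lintegral_prod_resample (P.map fun ω => (inp ω).draw) (P.map fun ω => (inp ω).coin) R'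
    hmix hg
  have hmm := hmix.measurable
  have h2 : Measurable fun z : ((List Bool × Bool × ℕ → Point d × Ξ) × (List Bool → Bool × Fin d)) ×
      (List Bool × Bool × ℕ → Ξ) => g ⟨fun i => φ i (z.1.1 i, z.2 i), z.1.2⟩ :=
    hg.comp ((hmm.comp (measurable_fst.fst.prodMk measurable_snd)).prodMk measurable_fst.snd)
  rw [← hinp.map_eq, lintegral_map hg hinp.measurable,
    lintegral_map (Measurable.lintegral_prod_right' h2) hinp.measurable] at h1
  exact h1

/-- The coin of a node may be resampled. -/
theorem IsInputs.lintegral_update_coin (hinp : IsInputs ρ κ P inp) {g : Inputs d Ξ → ℝ≥0∞}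
    (hg : Measurable fun z : (List Bool × Bool × ℕ → Point d × Ξ) × (List Bool → Bool × Fin d) =>
      g ⟨z.1, z.2⟩) (a : List Bool) :
    ∫⁻ ω, g (inp ω) ∂P = ∫⁻ ω, ∫⁻ c, g ⟨(inp ω).draw, Function.update (inp ω).coin a c⟩
      ∂(P.map fun ω => (inp ω).coin a) ∂P := by
  classical
  have hprobC : ∀ a, IsProbabilityMeasure (P.map fun ω => (inp ω).coin a) :=
    fun a => Measure.isProbabilityMeasure_map (hinp.measurable_coin a).aemeasurable
  have hprobD := Measure.isProbabilityMeasure_map (μ := P)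
    (measurable_pi_lambda (fun ω => (inp ω).draw) hinp.measurable_draw).aemeasurable
  have hprobC' := Measure.isProbabilityMeasure_map (μ := P)
    (measurable_pi_lambda (fun ω => (inp ω).coin) hinp.measurable_coin).aemeasurable
  set C := fun a => P.map fun ω => (inp ω).coin a
  set φ : List Bool → (Bool × Fin d) × (Bool × Fin d) → Bool × Fin d :=
    fun i z => if i = a then z.2 else z.1
  have hφ : ∀ i, Measurable (φ i) := fun i => measurable_of_countable _
  have hlaw : P.map (fun ω => (inp ω).coin) = Measure.infinitePi C :=
    hinp.indep_coin.map_fun_eq_infinitePi_map hinp.measurable_coin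
  -- First mix in a full independent copy of all coins, of which only coordinate `a` is used;
  -- projecting the copy to that coordinate gives the statement for one coin.
  have hmix0 : MeasurePreserving
      (fun z : (List Bool → Bool × Fin d) × (List Bool → Bool × Fin d) =>
        fun i => φ i (z.1 i, z.2 i))
      ((Measure.infinitePi C).prod (Measure.infinitePi C)) (Measure.infinitePi C) := by
    refine ⟨measurable_pi_lambda _ fun i => (hφ i).comp (by fun_prop), ?_⟩
    refine map_infinitePi_prod_infinitePi _ _ _ φ hφ fun i => ?_
    by_cases h : i = a
    · simp only [φ, h, if_true]
      exact (measurePreserving_snd (μ := C a) (ν := C a)).map_eq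
    · simp only [φ, h, if_false]
      exact (measurePreserving_fst (μ := C i) (ν := C i)).map_eq
  have hup : Measurable fun z : (List Bool → Bool × Fin d) × (Bool × Fin d) =>
      Function.update z.1 a z.2 := by
    refine measurable_pi_lambda _ fun i => ?_
    simp only [Function.update_apply]
    by_cases h : i = a <;> simp only [h, if_true, if_false] <;> fun_prop
  have hmix : MeasurePreserving
      (fun z : (List Bool → Bool × Fin d) × (Bool × Fin d) => Function.update z.1 a z.2)
      ((Measure.infinitePi C).prod (C a)) (Measure.infinitePi C) := by
    refine ⟨hup, ?_⟩
    have h1 := (MeasurePreserving.id (Measure.infinitePi C)).prod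
      (measurePreserving_eval_infinitePi C a)
    rw [← h1.map_eq, Measure.map_map hup h1.measurable]
    refine Eq.trans ?_ hmix0.map_eq
    congr 1
    funext z i
    simp only [φ, Function.comp, Prod.map, Function.update_apply, Function.eval, id]
    split_ifs with h
    · rw [h]
    · rfl
  have hg' : Measurable fun z : (List Bool → Bool × Fin d) × (List Bool × Bool × ℕ → Point d × Ξ) =>
      g ⟨z.2, z.1⟩ := hg.comp measurable_swap
  have h1 := lintegral_prod_resample (Measure.infinitePi C) (P.map fun ω => (inp ω).draw) (C a)
    hmix hg'
  have hmap : P.map (fun ω => ((inp ω).coin, (inp ω).draw)) =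
      (Measure.infinitePi C).prod (P.map fun ω => (inp ω).draw) := by
    rw [← hlaw, ← Measure.prod_swap, ← hinp.map_eq, Measure.map_map measurable_swap hinp.measurable]
    rfl
  have hmeas : Measurable fun ω => ((inp ω).coin, (inp ω).draw) :=
    measurable_swap.comp hinp.measurable
  have h2 : Measurable fun z : ((List Bool → Bool × Fin d) × (List Bool × Bool × ℕ → Point d × Ξ)) ×
      (Bool × Fin d) => g ⟨z.1.2, Function.update z.1.1 a z.2⟩ :=
    hg.comp (measurable_fst.snd.prodMk (hup.comp (measurable_fst.fst.prodMk measurable_snd)))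
  rw [← hmap, lintegral_map hg' hmeas,
    lintegral_map (Measurable.lintegral_prod_right' h2) hmeas] at h1
  exact h1

end Law

/-! ### Sums over the levels of the binary tree -/

/-- The sum of a function over all addresses of length `c`. -/
def levelSum : ℕ → (List Bool → ℝ≥0∞) → ℝ≥0∞
  | 0, g => g []
  | c + 1, g => levelSum c fun a => g (false :: a) + g (true :: a)

theorem levelSum_mono {c : ℕ} {g h : List Bool → ℝ≥0∞} (hgh : ∀ a, a.length = c → g a ≤ h a) :
    levelSum c g ≤ levelSum c h := by
  induction c generalizing g h with
  | zero => exact hgh [] rfl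
  | succ c ih => exact ih fun a ha => add_le_add (hgh _ (by simp [ha])) (hgh _ (by simp [ha]))

theorem levelSum_const (c : ℕ) (x : ℝ≥0∞) : levelSum c (fun _ => x) = 2 ^ c * x := by
  induction c generalizing x with
  | zero => simp [levelSum]
  | succ c ih => rw [levelSum, ih, pow_succ, mul_assoc, two_mul]

theorem levelSum_const_mul (c : ℕ) (x : ℝ≥0∞) (g : List Bool → ℝ≥0∞) :
    levelSum c (fun a => x * g a) = x * levelSum c g := by
  induction c generalizing g with
  | zero => rfl
  | succ c ih =>
    simp only [levelSum, ← mul_add]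
    exact ih _

theorem le_levelSum (g : List Bool → ℝ≥0∞) (a : List Bool) : g a ≤ levelSum a.length g := by
  induction a generalizing g with
  | nil => exact le_rfl
  | cons b a ih =>
    refine le_trans ?_ (ih _)
    cases b
    · exact le_self_add
    · exact le_add_self

theorem measurable_levelSum {Ω : Type*} [MeasurableSpace Ω] (c : ℕ) {g : Ω → List Bool → ℝ≥0∞}
    (hg : ∀ a, Measurable fun ω => g ω a) : Measurable fun ω => levelSum c (g ω) := by
  induction c generalizing g with
  | zero => exact hg []
  | succ c ih =>
    have := ih (g := fun ω a => g ω (false :: a) + g ω (true :: a)) fun a => (hg _).add (hg _)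
    exact this

theorem lintegral_levelSum {Ω : Type*} [MeasurableSpace Ω] (P : Measure Ω) (c : ℕ)
    {g : Ω → List Bool → ℝ≥0∞} (hg : ∀ a, Measurable fun ω => g ω a) :
    ∫⁻ ω, levelSum c (g ω) ∂P = levelSum c fun a => ∫⁻ ω, g ω a ∂P := by
  induction c generalizing g with
  | zero => rfl
  | succ c ih =>
    have := ih (g := fun ω a => g ω (false :: a) + g ω (true :: a)) fun a => (hg _).add (hg _)
    simp only [lintegral_add_left (hg _)] at this
    exact this

theorem measure_level_le {Ω : Type*} [MeasurableSpace Ω] (P : Measure Ω) (c : ℕ)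
    (E : List Bool → Set Ω) :
    P {ω | ∃ a, a.length = c ∧ ω ∈ E a} ≤ levelSum c fun a => P (E a) := by
  induction c generalizing E with
  | zero =>
    refine measure_mono ?_
    rintro ω ⟨a, ha, hω⟩
    rwa [List.length_eq_zero_iff.1 ha] at hω
  | succ c ih =>
    refine le_trans (measure_mono ?_) ((ih fun a => E (false :: a) ∪ E (true :: a)).trans
      (levelSum_mono fun a _ => measure_union_le _ _))
    rintro ω ⟨a, ha, hω⟩
    match a, ha with
    | b :: a, ha =>
      refine ⟨a, by simpa using ha, ?_⟩
      cases b
      · exact Or.inl hω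
      · exact Or.inr hω

/-- The first part of the Borel–Cantelli lemma, in the form that the probability of a late event
tends to zero. -/
theorem tendsto_measure_exists_ge {Ω : Type*} [MeasurableSpace Ω] (P : Measure Ω) (E : ℕ → Set Ω)
    (g : ℕ → ℝ≥0∞) (hE : ∀ᶠ c in atTop, P (E c) ≤ g c) (hg : ∑' c, g c ≠ ∞) :
    Tendsto (fun m => P {ω | ∃ c, m ≤ c ∧ ω ∈ E c}) atTop (𝓝 0) := by
  refine tendsto_of_tendsto_of_tendsto_of_le_of_le' tendsto_const_nhds
    (ENNReal.tendsto_sum_nat_add g hg) (Eventually.of_forall fun _ => zero_le) ?_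
  obtain ⟨c₀, hc₀⟩ := eventually_atTop.1 hE
  filter_upwards [eventually_ge_atTop c₀] with m hm
  refine (measure_mono (t := ⋃ k, E (k + m)) ?_).trans ((measure_iUnion_le _).trans
    (ENNReal.tsum_le_tsum fun k => hc₀ _ (by omega)))
  rintro ω ⟨c, hc, hω⟩
  exact Set.mem_iUnion.2 ⟨c - m, by rwa [Nat.sub_add_cancel hc]⟩

section Probability

variable {d : ℕ} {Ξ : Type*} [MeasurableSpace Ξ] {Ω : Type*} [MeasurableSpace Ω]
  {P : Measure Ω} [IsProbabilityMeasure P]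
  {p : Params} {rule : SplitRule d} {M : Model d Ξ} {N₀ : ℕ}
  {inp : Ω → Inputs d Ξ}

/-! ### Concentration of the sample means -/

/-- `Inputs` carries no σ-algebra; the two resampling identities ask for measurability on pairs of a
draw array and a coin array. -/
theorem measurableInputs_mk : MeasurableInputs
    fun z : (List Bool × Bool × ℕ → Point d × Ξ) × (List Bool → Bool × Fin d) =>
      (⟨z.1, z.2⟩ : Inputs d Ξ) :=
  ⟨fun _ => by dsimp only; fun_prop, fun _ => by dsimp only; fun_prop⟩

theorem measurableSet_forall_cube {Ω' : Type*} [MeasurableSpace Ω'] {inp' : Ω' → Inputs d Ξ}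
    (hi : MeasurableInputs inp') : MeasurableSet {w | ∀ i, ((inp' w).draw i).1 ∈ cube d} := by
  rw [Set.ofPred_forall]
  exact MeasurableSet.iInter fun i => (hi.draw i).fst measurableSet_cube

theorem measurableSet_noisy (hrule : IsSplitRule p rule) {Ω' : Type*} [MeasurableSpace Ω']
    {inp' : Ω' → Inputs d Ξ} (hi : MeasurableInputs inp') (δ : ℝ) (a : List Bool) (k : ℕ) :
    MeasurableSet {w | inp' w ∈ noisy p rule M N₀ δ a k} := by
  have hV := measurableNode_node (M := M) (N₀ := N₀) hrule hi a
  have hL := measurable_iterate_grow (p := p) (M := M) hi hV.leaf hV.addr k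
  obtain ⟨-, ⟨hI, -⟩, -⟩ := measurable_leaf_iff.1 hL
  refine (measurableSet_forall_cube hi).inter ((hV.alive (measurableSet_singleton true)).inter ?_)
  have hcast : Measurable fun n : ℕ => (n : ℝ) := measurable_from_nat
  refine measurableSet_le ((hcast.comp (measurable_list_length hI)).const_mul δ) ?_
  exact (measurable_list_sum (measurable_list_map
    (measurable_snd.sub (M.measurable_μ.comp measurable_fst)) hI)).abs

/-- Conditioning on everything except the 𝓘-noise is realized by resampling that noise; the bound on
the inner integral is uniform in the frozen inputs. -/
theorem measure_noisy_le (hinp : IsInputs M.ρ p.κ P inp) (hp : p.Valid)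
    (hrule : IsSplitRule p rule) {c : ℝ≥0} (hc : 0 < c)
    (hsub : ∀ x ∈ cube d, HasSubgaussianMGF (M.noise x) c M.ρ) {δ : ℝ} (hδ : 0 < δ)
    (a : List Bool) (b : Bool) (k : ℕ) :
    P {ω | inp ω ∈ noisy p rule M N₀ δ (b :: a) k} ≤
      ENNReal.ofReal (2 * Real.exp (-(δ ^ 2 / (2 * c)) * (p.β * p.f a.length + k))) := by
  have := M.isProbabilityMeasure
  have hi : MeasurableInputs inp := ⟨hinp.measurable_draw, hinp.measurable_coin⟩
  set B := noisy p rule M N₀ δ (b :: a) k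
  have h1 : P {ω | inp ω ∈ B} = ∫⁻ ω, B.indicator 1 (inp ω) ∂P :=
    (lintegral_indicator_one (measurableSet_noisy hrule hi δ (b :: a) k)).symm
  have hg : Measurable fun z : (List Bool × Bool × ℕ → Point d × Ξ) × (List Bool → Bool × Fin d) =>
      B.indicator (1 : Inputs d Ξ → ℝ≥0∞) ⟨z.1, z.2⟩ :=
    (measurable_one (α := ℝ≥0∞)).indicator
      (measurableSet_noisy hrule measurableInputs_mk δ (b :: a) k)
  rw [h1, hinp.lintegral_withNoise hg]
  calc _ ≤ ∫⁻ _, ENNReal.ofReal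
        (2 * Real.exp (-(δ ^ 2 / (2 * c)) * (p.β * p.f a.length + k))) ∂P := by
        refine lintegral_mono fun ω => ?_
        refine le_trans ?_ (measure_withNoise_noisy_le (rule := rule) (N₀ := N₀) hp hc hsub hδ a b k (inp ω))
        exact lintegral_indicator_one_le (s := {ξ | withNoise (inp ω) ξ ∈ B})
    _ = _ := by rw [lintegral_const, measure_univ, mul_one]

/-- The visit count is chosen by the strategy, so the union runs over all `k` as well as over the `2
^ (n + 1)` addresses. The sum over `k` is geometric, and superlinear growth of `f` pays for the
addresses. -/
theorem tendsto_measure_noisy (hinp : IsInputs M.ρ p.κ P inp) (hp : p.Valid)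
    (hrule : IsSplitRule p rule) {c : ℝ≥0} (hc : 0 < c)
    (hsub : ∀ x ∈ cube d, HasSubgaussianMGF (M.noise x) c M.ρ) {δ : ℝ} (hδ : 0 < δ)
    (hf : ∀ A : ℝ, 0 < A → ∀ᶠ n : ℕ in atTop, A * n ≤ p.f n) :
    Tendsto (fun m => P {ω | ∃ n, m ≤ n ∧ ∃ a : List Bool, a.length = n + 1 ∧
      ∃ k, inp ω ∈ noisy p rule M N₀ δ a k}) atTop (𝓝 0) := by
  set θ : ℝ := δ ^ 2 / (2 * c)
  have hθ : 0 < θ := by positivity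
  set K : ℝ≥0∞ := ∑' k : ℕ, ENNReal.ofReal (Real.exp (-θ * k))
  have hK : K ≠ ∞ := by
    have h1 : Summable fun k : ℕ => Real.exp (-θ * k) := by
      have := summable_geometric_of_lt_one (Real.exp_nonneg (-θ))
        (Real.exp_lt_one_iff.2 (by linarith))
      refine this.congr fun k => ?_
      rw [← Real.exp_nat_mul, mul_comm]
    exact h1.tsum_ofReal_ne_top
  have hβ := hp.β_pos
  refine tendsto_measure_exists_ge P
    (fun n => {ω | ∃ a : List Bool, a.length = n + 1 ∧ ∃ k, inp ω ∈ noisy p rule M N₀ δ a k})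
    (fun n => 4 * K * 2⁻¹ ^ n) ?_ ?_
  -- This slope gives `exp(-θ β f(n)) ≤ 4 ^ (-n)`, which against `2 ^ (n + 1)` addresses leaves a
  -- multiple of `2 ^ (-n)`.
  · filter_upwards [hf (Real.log 4 / (θ * p.β)) (by positivity)] with n hn
    have hn' : Real.log 4 * n ≤ θ * (p.β * p.f n) := by
      have := mul_le_mul_of_nonneg_left hn (show 0 ≤ θ * p.β by positivity)
      have h2 : θ * p.β * (Real.log 4 / (θ * p.β) * n) = Real.log 4 * n := by field_simp
      linarith
    have hexp : Real.exp (-θ * (p.β * p.f n)) ≤ (1 / 4) ^ n := by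
      have h3 : ((1 : ℝ) / 4) ^ n = Real.exp (-(Real.log 4 * n)) := by
        rw [Real.exp_neg, mul_comm, Real.exp_nat_mul, Real.exp_log (by norm_num), one_div, inv_pow]
      rw [h3]
      exact Real.exp_le_exp.2 (by linarith)
    have hone : ∀ a : List Bool, a.length = n + 1 →
        P {ω | ∃ k, inp ω ∈ noisy p rule M N₀ δ a k} ≤ ENNReal.ofReal (2 * (1 / 4) ^ n) * K := by
      intro a ha
      match a, ha with
      | b :: a, ha =>
        have ha' : a.length = n := by simpa using ha
        rw [Set.ofPred_exists]
        refine (measure_iUnion_le _).trans ?_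
        rw [← ENNReal.tsum_mul_left]
        refine ENNReal.tsum_le_tsum fun k => ?_
        refine (measure_noisy_le hinp hp hrule hc hsub hδ a b k).trans ?_
        rw [← ENNReal.ofReal_mul (by positivity)]
        refine ENNReal.ofReal_le_ofReal ?_
        rw [ha', mul_add, Real.exp_add, ← mul_assoc]
        gcongr
    refine (measure_level_le P (n + 1) fun a => {ω | ∃ k, inp ω ∈ noisy p rule M N₀ δ a k}).trans ?_
    refine (levelSum_mono hone).trans (le_of_eq ?_)
    rw [levelSum_const, ENNReal.ofReal_mul (by norm_num), ENNReal.ofReal_pow (by norm_num)]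
    have h4 : ENNReal.ofReal (1 / 4) = 2⁻¹ * 2⁻¹ := by
      rw [show (1 : ℝ) / 4 = 2⁻¹ * 2⁻¹ by norm_num, ENNReal.ofReal_mul (by norm_num),
        ENNReal.ofReal_inv_of_pos (by norm_num)]
      simp
    have h5 : (2 : ℝ≥0∞) ^ n * 2⁻¹ ^ n = 1 := by
      rw [← mul_pow, ENNReal.mul_inv_cancel (by norm_num) (by norm_num), one_pow]
    rw [h4, mul_pow, show ENNReal.ofReal 2 = 2 by simp]
    calc (2 : ℝ≥0∞) ^ (n + 1) * (2 * (2⁻¹ ^ n * 2⁻¹ ^ n) * K)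
        = (2 ^ n * 2⁻¹ ^ n) * (2 * 2 * K * 2⁻¹ ^ n) := by ring
      _ = 4 * K * 2⁻¹ ^ n := by rw [h5, one_mul]; norm_num
  · rw [ENNReal.tsum_mul_left, ENNReal.tsum_geometric]
    refine ENNReal.mul_ne_top (ENNReal.mul_ne_top (by norm_num) hK) ?_
    rw [ENNReal.one_sub_inv_two, inv_inv]
    norm_num

/-! ### The rectangles around a point shrink -/

/-- A node is shaped by the splits of its proper ancestors, which use only coins of strictly shorter
addresses; `grow` uses none. The coin of a node is thus independent of its rectangle and of its
being on the path. -/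
theorem node_congr_coin {D : List Bool × Bool × ℕ → Point d × Ξ} {C C' : List Bool → Bool × Fin d}
    (x : Point d) : ∀ a : List Bool, (∀ a' : List Bool, a'.length < a.length → C a' = C' a') →
      node p rule M N₀ ⟨D, C⟩ a = node p rule M N₀ ⟨D, C'⟩ a ∧
      (OnPath p rule M N₀ x ⟨D, C⟩ a ↔ OnPath p rule M N₀ x ⟨D, C'⟩ a)
  | [], _ => ⟨rfl, Iff.rfl⟩
  | b :: a, h => by
    classical
    obtain ⟨h1, h2⟩ := node_congr_coin (D := D) x a fun a' ha' => h a' (ha'.trans (by simp))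
    have h3 : C a = C' a := h a (by simp)
    have hgrow : grow p M ⟨D, C⟩ = grow p M ⟨D, C'⟩ := rfl
    have hprop : ∀ L : Leaf d, L.addr = a → proposal rule (⟨D, C⟩ : Inputs d Ξ) L =
        proposal rule (⟨D, C'⟩ : Inputs d Ξ) L := by
      intro L hL
      simp only [proposal, hL, h3]
    have haddr := fun k => (grow_addr p M ⟨D, C'⟩ (node p rule M N₀ ⟨D, C'⟩ a).leaf k).trans
      (node_addr p rule M N₀ ⟨D, C'⟩ a)
    have hsplit : ∀ k, (node p rule M N₀ ⟨D, C'⟩ a).SplitsAt p rule M ⟨D, C⟩ k ↔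
        (node p rule M N₀ ⟨D, C'⟩ a).SplitsAt p rule M ⟨D, C'⟩ k := by
      intro k
      simp only [Node.SplitsAt, Splits, hgrow, hprop _ (haddr k)]
      simp only [haddr, h3]
    have htime : (node p rule M N₀ ⟨D, C'⟩ a).splitTime p rule M ⟨D, C⟩ =
        (node p rule M N₀ ⟨D, C'⟩ a).splitTime p rule M ⟨D, C'⟩ :=
      splitTime_congr p rule M hsplit
    have hlast : (node p rule M N₀ ⟨D, C'⟩ a).last p rule M ⟨D, C⟩ =
        (node p rule M N₀ ⟨D, C'⟩ a).last p rule M ⟨D, C'⟩ := by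
      simp only [Node.last, htime, hgrow]
    have hprop' := hprop _ (last_addr p rule M N₀ ⟨D, C'⟩ a)
    constructor
    · simp only [node, h1, htime, hlast, hsplit, child, hprop']
    · simp only [OnPath, h1, h2, hlast, hprop']

open Classical in
/-- The length of side `j` of a node on the path of `x`, zero for the other nodes. -/
def pathSide (p : Params) (rule : SplitRule d) (M : Model d Ξ) (N₀ : ℕ) (x : Point d) (j : Fin d)
    (w : Inputs d Ξ) (a : List Bool) : ℝ≥0∞ :=
  if (∀ i, (w.draw i).1 ∈ cube d) ∧ (node p rule M N₀ w a).alive = true ∧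
      OnPath p rule M N₀ x w a then
    ENNReal.ofReal ((node p rule M N₀ w a).leaf.hi j - (node p rule M N₀ w a).leaf.lo j)
  else 0

theorem measurable_pathSide (hrule : IsSplitRule p rule) {Ω' : Type*} [MeasurableSpace Ω']
    {inp' : Ω' → Inputs d Ξ} (hi : MeasurableInputs inp') (x : Point d) (j : Fin d)
    (a : List Bool) : Measurable fun w => pathSide p rule M N₀ x j (inp' w) a := by
  classical
  have hV := measurableNode_node (M := M) (N₀ := N₀) hrule hi a
  obtain ⟨⟨h1, h2⟩, -⟩ := measurable_leaf_iff.1 hV.leaf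
  refine Measurable.ite ((measurableSet_forall_cube hi).inter
    ((hV.alive (measurableSet_singleton true)).inter (measurableSet_onPath hrule hi x a))) ?_
    measurable_const
  fun_prop

/-- The two sides of the cut exclude each other, so at most one child is on the path of `x`. If that
child is alive, then its parent is alive and has split, and the coin bounds the side. -/
theorem pathSide_cons_le (hp : p.Valid) (x : Point d) (j : Fin d) (w : Inputs d Ξ)
    (a : List Bool) :
    pathSide p rule M N₀ x j w (false :: a) + pathSide p rule M N₀ x j w (true :: a) ≤
      pathSide p rule M N₀ x j w a * ENNReal.ofReal (shrink p.α j (w.coin a)) := by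
  classical
  have hone : ∀ b, pathSide p rule M N₀ x j w (b :: a) ≤
      pathSide p rule M N₀ x j w a * ENNReal.ofReal (shrink p.α j (w.coin a)) := by
    intro b
    unfold pathSide
    by_cases h : (∀ i, (w.draw i).1 ∈ cube d) ∧ (node p rule M N₀ w (b :: a)).alive = true ∧
      OnPath p rule M N₀ x w (b :: a)
    · have h1 := (alive_cons p rule M N₀ w h.2.1).1
      rw [if_pos h, if_pos ⟨h.1, h1, h.2.2.1⟩, mul_comm, ← ENNReal.ofReal_mul]
      · exact ENNReal.ofReal_le_ofReal (side_node_cons_le hp h.1 h.2.1 j)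
      · unfold shrink
        have := hp.α_le
        split_ifs <;> linarith
    · rw [if_neg h]
      exact zero_le
  have hzero : ∀ b, ¬ OnPath p rule M N₀ x w (b :: a) →
      pathSide p rule M N₀ x j w (b :: a) = 0 := by
    intro b h
    unfold pathSide
    rw [if_neg fun h' => h h'.2.2]
  by_cases h : OnPath p rule M N₀ x w (true :: a)
  · have h' : ¬ OnPath p rule M N₀ x w (false :: a) := fun h' =>
      Bool.false_ne_true (h'.2.2 (h.2.1 rfl))
    rw [hzero _ h', zero_add]
    exact hone _
  · rw [hzero _ h, add_zero]
    exact hone _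

theorem pathSide_congr_coin (x : Point d) (j : Fin d) (w : Inputs d Ξ) (a : List Bool)
    (c : Bool × Fin d) :
    pathSide p rule M N₀ x j ⟨w.draw, Function.update w.coin a c⟩ a =
      pathSide p rule M N₀ x j w a := by
  obtain ⟨h1, h2⟩ := node_congr_coin (p := p) (rule := rule) (M := M) (N₀ := N₀) (D := w.draw)
    (C := Function.update w.coin a c) (C' := w.coin) x a fun a' ha' =>
      Function.update_of_ne (fun h => by rw [h] at ha'; exact lt_irrefl _ ha') _ _
  classical
  exact if_congr (and_congr_right fun _ => by rw [h1, h2]) (by rw [h1]) rfl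

/-- The expected factor by which a side shrinks at a split. -/
theorem lintegral_shrink (hinp : IsInputs M.ρ p.κ P inp) (hp : p.Valid) (j : Fin d)
    (a : List Bool) :
    ∫⁻ c, ENNReal.ofReal (shrink p.α j c) ∂(P.map fun ω => (inp ω).coin a) =
      ENNReal.ofReal (1 - p.α * (p.κ / d)) := by
  have := Measure.isProbabilityMeasure_map (μ := P) (hinp.measurable_coin a).aemeasurable
  set R := P.map fun ω => (inp ω).coin a
  have hA : R.real {(true, j)} = p.κ / d := by
    have h1 := hinp.law_coin a true j
    have h2 : R {(true, j)} = P {ω | (inp ω).coin a = (true, j)} :=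
      Measure.map_apply (hinp.measurable_coin a) (measurableSet_singleton _)
    have := hp.κ_pos
    rw [Measure.real, h2, h1, if_pos rfl, ENNReal.toReal_ofReal (by positivity)]
  have hnn : ∀ c : Bool × Fin d, 0 ≤ shrink p.α j c := by
    intro c
    unfold shrink
    have := hp.α_le
    split_ifs <;> linarith
  rw [← ofReal_integral_eq_lintegral_ofReal .of_finite (Eventually.of_forall hnn)]
  congr 1
  have h3 : ∀ c : Bool × Fin d, shrink p.α j c =
      1 - ({(true, j)} : Set (Bool × Fin d)).indicator (fun _ => p.α) c := by
    intro c
    unfold shrink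
    by_cases h : c = (true, j) <;> simp [h]
  simp only [h3]
  rw [integral_sub .of_finite .of_finite, integral_indicator (measurableSet_singleton _)]
  simp only [integral_const, probReal_univ, smul_eq_mul, mul_one, measureReal_restrict_apply_univ,
    hA]
  ring

/-- Induction on the depth: `pathSide` at `a` does not see the coin of `a`, so resampling this coin
takes out the mean factor `1 - α κ / d`. Siblings are merged before summing, hence no factor `2 ^ c`
appears. -/
theorem lintegral_pathSide_le (hinp : IsInputs M.ρ p.κ P inp) (hp : p.Valid)
    (hrule : IsSplitRule p rule) (x : Point d) (j : Fin d) (c : ℕ) :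
    ∫⁻ ω, levelSum c (pathSide p rule M N₀ x j (inp ω)) ∂P ≤
      ENNReal.ofReal (1 - p.α * (p.κ / d)) ^ c := by
  classical
  have := M.isProbabilityMeasure
  have hi : MeasurableInputs inp := ⟨hinp.measurable_draw, hinp.measurable_coin⟩
  have hmeas := fun a => measurable_pathSide (M := M) (N₀ := N₀) hrule hi x j a
  induction c with
  | zero =>
    rw [pow_zero]
    calc _ ≤ ∫⁻ _, (1 : ℝ≥0∞) ∂P := by
          refine lintegral_mono fun ω => ?_
          simp only [levelSum, pathSide]
          split_ifs with h
          · have h1 := node_wellPlaced (p := p) (rule := rule) (M := M) (N₀ := N₀) hp h.1 [] h.2.1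
            refine ENNReal.ofReal_le_one.2 ?_
            linarith [h1.lo_nonneg j, h1.hi_le_one j]
          · exact zero_le
      _ = 1 := by simp
  | succ c ih =>
    calc _ ≤ ∫⁻ ω, levelSum c (fun a => pathSide p rule M N₀ x j (inp ω) a *
            ENNReal.ofReal (shrink p.α j ((inp ω).coin a))) ∂P :=
          lintegral_mono fun ω => levelSum_mono fun a _ => pathSide_cons_le hp x j (inp ω) a
      _ = levelSum c fun a => ∫⁻ ω, pathSide p rule M N₀ x j (inp ω) a *
            ENNReal.ofReal (shrink p.α j ((inp ω).coin a)) ∂P :=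
          lintegral_levelSum P c fun a => (hmeas a).mul
            ((measurable_of_countable fun q => ENNReal.ofReal (shrink p.α j q)).comp
              (hinp.measurable_coin a))
      _ = levelSum c fun a => ENNReal.ofReal (1 - p.α * (p.κ / d)) *
            ∫⁻ ω, pathSide p rule M N₀ x j (inp ω) a ∂P := by
          congr 1
          funext a
          have hg : Measurable fun z : (List Bool × Bool × ℕ → Point d × Ξ) ×
              (List Bool → Bool × Fin d) => pathSide p rule M N₀ x j ⟨z.1, z.2⟩ a *
                ENNReal.ofReal (shrink p.α j (z.2 a)) :=
            (measurable_pathSide hrule measurableInputs_mk x j a).mul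
              ((measurable_of_countable fun q => ENNReal.ofReal (shrink p.α j q)).comp
                (by fun_prop))
          rw [hinp.lintegral_update_coin (g := fun w => pathSide p rule M N₀ x j w a *
            ENNReal.ofReal (shrink p.α j (w.coin a))) hg a, ← lintegral_const_mul _ (hmeas a)]
          refine lintegral_congr fun ω => ?_
          simp only [pathSide_congr_coin, Function.update_self]
          rw [lintegral_const_mul _ (measurable_of_countable _), lintegral_shrink hinp hp j a,
            mul_comm]
      _ ≤ _ := by
          rw [levelSum_const_mul, ← lintegral_levelSum P c hmeas, pow_succ, mul_comm]
          gcongr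

/-- The probability that a late rectangle around `x` has a long side tends to zero. -/
theorem tendsto_measure_pathSide (hinp : IsInputs M.ρ p.κ P inp) (hp : p.Valid)
    (hrule : IsSplitRule p rule) (x : Point d) (j : Fin d) {η : ℝ} (hη : 0 < η) :
    Tendsto (fun m => P {ω | ∃ c, m ≤ c ∧ ∃ a : List Bool, a.length = c ∧
      ENNReal.ofReal η ≤ pathSide p rule M N₀ x j (inp ω) a}) atTop (𝓝 0) := by
  have hi : MeasurableInputs inp := ⟨hinp.measurable_draw, hinp.measurable_coin⟩
  have hmeas := fun a => measurable_pathSide (M := M) (N₀ := N₀) hrule hi x j a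
  have hη' : ENNReal.ofReal η ≠ 0 := by simpa using hη
  refine tendsto_measure_exists_ge P (fun c => {ω | ∃ a : List Bool, a.length = c ∧
      ENNReal.ofReal η ≤ pathSide p rule M N₀ x j (inp ω) a})
    (fun c => ENNReal.ofReal (1 - p.α * (p.κ / d)) ^ c * (ENNReal.ofReal η)⁻¹)
    (Eventually.of_forall fun c => ?_) ?_
  -- Markov's inequality for the level sum, which dominates each of its terms.
  · have h1 := meas_ge_le_lintegral_div (μ := P) (measurable_levelSum c hmeas).aemeasurable hη'
      ENNReal.ofReal_ne_top
    refine (measure_mono ?_).trans (h1.trans ?_)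
    · rintro ω ⟨a, rfl, ha⟩
      exact ha.trans (le_levelSum _ a)
    · rw [ENNReal.div_eq_inv_mul, mul_comm]
      gcongr
      exact lintegral_pathSide_le hinp hp hrule x j c
  · rw [ENNReal.tsum_mul_right, ENNReal.tsum_geometric]
    refine ENNReal.mul_ne_top ?_ (ENNReal.inv_ne_top.2 hη')
    refine ENNReal.inv_ne_top.2 (tsub_pos_of_lt ?_).ne'
    have hd : (0 : ℝ) < d := by exact_mod_cast j.pos
    have := hp.α_pos
    have := hp.κ_pos
    have : 0 < p.α * (p.κ / d) := by positivity
    exact ENNReal.ofReal_lt_one.2 (by linarith)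

end Probability

section Consistency

set_option linter.unusedSectionVars false

/-! ### The growth of the threshold -/

/-- The depth condition forces the sample threshold to grow faster than the depth. -/
theorem eventually_mul_le_threshold {d : ℕ} {Ξ : Type*} [MeasurableSpace Ξ] {p : Params}
    (hp : p.Valid) (N₀ : ℕ) (M : Model d Ξ) {Ω : Type*} [MeasurableSpace Ω] (P : Measure Ω)
    [IsProbabilityMeasure P] (inp : Ω → Inputs d Ξ) (rule : SplitRule d) {V : Type*}
    (strat : Strategy d V) (hstrat : strat.SelectsLeaf) (seed : Ω → V) (hminus hplus : ℕ → ℕ)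
    (hdepth : Tendsto (fun N => P {ω | ¬ ∀ L ∈ finalLeaves p rule M strat N₀ (inp ω) (seed ω) N,
        hminus N ≤ L.depth ∧ L.depth ≤ hplus N}) atTop (𝓝 0))
    (hminus_top : Tendsto hminus atTop atTop)
    (hratio : Tendsto (fun N => (hplus N : ℝ) / p.f (hminus N)) atTop (𝓝 0))
    {A : ℝ} (hA : 0 < A) : ∀ᶠ n : ℕ in atTop, A * n ≤ p.f n := by
  classical
  have h1 := hratio.eventually (gt_mem_nhds (show (0 : ℝ) < A⁻¹ by positivity))
  -- Failure probabilities below `1/2` ensure that the depth bounds for two consecutive budgets hold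
  -- at a common outcome.
  have h2 := hdepth.eventually (gt_mem_nhds (show (0 : ℝ≥0∞) < 2⁻¹ by simp))
  obtain ⟨N₁, hN₁⟩ := eventually_atTop.1 (h1.and h2)
  -- Such a `c` is not exceeded by `hminus` up to budget `N₁`, so the first budget at which it is
  -- exceeded comes later.
  filter_upwards [eventually_ge_atTop ((Finset.range (N₁ + 1)).sup hminus)] with c hc
  have hex : ∃ N, c < hminus N := (hminus_top.eventually (eventually_gt_atTop c)).exists
  obtain ⟨N, hN, hlt⟩ : ∃ N, c < hminus N ∧ ∀ n < N, hminus n ≤ c :=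
    ⟨Nat.find hex, Nat.find_spec hex, fun n hn => not_lt.1 (Nat.find_min hex hn)⟩
  have hNN : N₁ + 1 ≤ N := by
    by_contra h
    have h3 : hminus N ≤ (Finset.range (N₁ + 1)).sup hminus :=
      Finset.le_sup (Finset.mem_range.2 (by omega))
    omega
  obtain ⟨n, rfl⟩ : ∃ n, N = n + 1 := ⟨N - 1, by omega⟩
  set bad := fun N => {ω | ¬ ∀ L ∈ finalLeaves p rule M strat N₀ (inp ω) (seed ω) N,
    hminus N ≤ L.depth ∧ L.depth ≤ hplus N}
  have hlt1 : P (bad n ∪ bad (n + 1)) < 1 := by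
    refine (measure_union_le _ _).trans_lt ?_
    rw [← ENNReal.inv_two_add_inv_two]
    exact ENNReal.add_lt_add (hN₁ n (by omega)).2 (hN₁ (n + 1) (by omega)).2
  obtain ⟨ω, hω⟩ : ∃ ω, ω ∉ bad n ∪ bad (n + 1) := by
    by_contra h
    push Not at h
    rw [Set.eq_univ_of_forall h, measure_univ] at hlt1
    exact lt_irrefl _ hlt1
  have hω1 : ∀ L ∈ finalLeaves p rule M strat N₀ (inp ω) (seed ω) n,
      hminus n ≤ L.depth ∧ L.depth ≤ hplus n := by
    by_contra h
    exact hω (Or.inl h)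
  have hω2 : ∀ L ∈ finalLeaves p rule M strat N₀ (inp ω) (seed ω) (n + 1),
      hminus (n + 1) ≤ L.depth ∧ L.depth ≤ hplus (n + 1) := by
    by_contra h
    exact hω (Or.inr h)
  -- With budget `n + 1` all leaves are deeper than `c`, so with budget `n` some leaf has depth at
  -- least `c`. Hence `A c ≤ A hplus(n) < f(hminus(n)) ≤ f(c)`, the last step because `hminus n ≤
  -- c`.
  obtain ⟨L, hL, hLc⟩ := exists_depth_le_finalLeaves p rule M N₀ (inp ω) (seed ω) hstrat
    (N := n) (c := c) fun L hL => (hN.trans_le (hω2 L hL).1)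
  have hfpos := hp.f_pos (hminus n)
  have h5 := (hN₁ n (by omega)).1
  rw [div_lt_iff₀ hfpos, inv_mul_eq_div, lt_div_iff₀ hA] at h5
  have h6 : (c : ℝ) ≤ hplus n := by exact_mod_cast hLc.trans (hω1 L hL).2
  have h7 := hp.f_mono (hlt n (Nat.lt_succ_self n))
  nlinarith

/-! ### The sample mean of a leaf -/

variable {d : ℕ} {Ξ : Type*} [MeasurableSpace Ξ]

theorem norm_sub_le_of_coord {x y : Point d} {η : ℝ} (hη : 0 ≤ η) (h : ∀ j, |x j - y j| ≤ η) :
    ‖x - y‖ ≤ d * η := by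
  rw [EuclideanSpace.norm_eq, Real.sqrt_le_iff]
  refine ⟨by positivity, ?_⟩
  calc ∑ j, ‖(x - y) j‖ ^ 2 ≤ ∑ _j : Fin d, η ^ 2 := by
        refine Finset.sum_le_sum fun j _ => ?_
        rw [Real.norm_eq_abs]
        exact pow_le_pow_left₀ (abs_nonneg _) (h j) 2
    _ = d * η ^ 2 := by simp
    _ ≤ (d * η) ^ 2 := by
        rw [mul_pow]
        have : (d : ℝ) ≤ (d : ℝ) ^ 2 := by exact_mod_cast Nat.le_self_pow two_ne_zero d
        exact mul_le_mul_of_nonneg_right this (sq_nonneg _)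

theorem sum_dataI_eq (M : Model d Ξ) (L : Leaf d) :
    (L.dataI.map Prod.snd).sum = (L.dataI.map fun s => M.μ s.1).sum + deviation M L := by
  rw [deviation, ← List.sum_map_add]
  congr 1
  refine List.map_congr_left fun s _ => ?_
  ring

theorem sampleMean_le {M : Model d Ξ} {L : Leaf d} {m δ : ℝ} (hne : 0 < L.dataI.length)
    (hμ : ∀ s ∈ L.dataI, M.μ s.1 ≤ m) (hdev : |deviation M L| < δ * L.dataI.length) :
    L.sampleMean ≤ m + δ := by
  have hn : (0 : ℝ) < L.dataI.length := by exact_mod_cast hne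
  have h1 : (L.dataI.map fun s => M.μ s.1).sum ≤ L.dataI.length * m := by
    have := List.sum_le_card_nsmul (L.dataI.map fun s => M.μ s.1) m fun y hy => by
      obtain ⟨s, hs, rfl⟩ := List.mem_map.1 hy
      exact hμ s hs
    simpa using this
  rw [Leaf.sampleMean, average, List.length_map, div_le_iff₀ hn, sum_dataI_eq M]
  have := (abs_lt.1 hdev).2
  linarith

theorem le_sampleMean {M : Model d Ξ} {L : Leaf d} {m δ : ℝ} (hne : 0 < L.dataI.length)
    (hμ : ∀ s ∈ L.dataI, m ≤ M.μ s.1) (hdev : |deviation M L| < δ * L.dataI.length) :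
    m - δ ≤ L.sampleMean := by
  have hn : (0 : ℝ) < L.dataI.length := by exact_mod_cast hne
  have h1 : L.dataI.length * m ≤ (L.dataI.map fun s => M.μ s.1).sum := by
    have := List.card_nsmul_le_sum (L.dataI.map fun s => M.μ s.1) m fun y hy => by
      obtain ⟨s, hs, rfl⟩ := List.mem_map.1 hy
      exact hμ s hs
    simpa using this
  rw [Leaf.sampleMean, average, List.length_map, le_div_iff₀ hn, sum_dataI_eq M]
  have := (abs_lt.1 hdev).1
  linarith

variable {p : Params} {rule : SplitRule d} {M : Model d Ξ} {N₀ : ℕ} {w : Inputs d Ξ}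

/-- A current leaf below the root is well placed, and is not empty; if its address is not noisy,
then its average deviation is small. -/
theorem IsCurrent.properties (hp : p.Valid) (hw : ∀ i, (w.draw i).1 ∈ cube d) {L : Leaf d}
    (hL : IsCurrent p rule M N₀ w L) (hdepth : 1 ≤ L.depth) {δ : ℝ}
    (hquiet : ∀ k, w ∉ noisy p rule M N₀ δ L.addr k) :
    L.WellPlaced ∧ 0 < L.dataI.length ∧ |deviation M L| < δ * L.dataI.length := by
  obtain ⟨halive, k, hLk, -⟩ := hL
  refine ⟨?_, ?_, ?_⟩
  · rw [hLk]
    exact (node_wellPlaced hp hw _ halive).iterate_grow hw k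
  · obtain ⟨b, a, hba⟩ : ∃ b a, L.addr = b :: a := by
      cases h : L.addr with
      | nil => simp [Leaf.depth, h] at hdepth
      | cons b a => exact ⟨b, a, rfl⟩
    have h1 := length_dataI_grow p M w (node p rule M N₀ w L.addr).leaf k
    rw [← hLk] at h1
    rw [hba] at halive h1
    have h2 := length_dataI_node a b halive
    have h3 : (0 : ℝ) < (node p rule M N₀ w (b :: a)).leaf.dataI.length :=
      (mul_pos hp.β_pos (hp.f_pos _)).trans_le h2
    have h4 : 0 < (node p rule M N₀ w (b :: a)).leaf.dataI.length := by exact_mod_cast h3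
    omega
  · by_contra h
    refine hquiet k ⟨hw, halive, ?_⟩
    rw [← hLk]
    exact not_lt.1 h

/-- If the rectangle of a leaf on the path of `x` is small, then `x` is close to the `𝓘`-samples. -/
theorem IsCurrent.dist_le (hw : ∀ i, (w.draw i).1 ∈ cube d) {L : Leaf d}
    (hL : IsCurrent p rule M N₀ w L) (hwp : L.WellPlaced) {x : Point d} (hx : x ∈ cube d)
    (hpath : OnPath p rule M N₀ x w L.addr) {η : ℝ} (hη : 0 ≤ η)
    (hside : ∀ j, ¬ ENNReal.ofReal η ≤ pathSide p rule M N₀ x j w L.addr) {s : Point d × ℝ}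
    (hs : s ∈ L.dataI) : ‖s.1 - x‖ ≤ d * η := by
  classical
  obtain ⟨halive, k, hLk, -⟩ := hL
  have hlo : L.lo = (node p rule M N₀ w L.addr).leaf.lo := by
    conv_lhs => rw [hLk]
    exact grow_lo p M w _ k
  have hhi : L.hi = (node p rule M N₀ w L.addr).leaf.hi := by
    conv_lhs => rw [hLk]
    exact grow_hi p M w _ k
  refine norm_sub_le_of_coord hη fun j => ?_
  have h1 := mem_box_of_onPath hx L.addr hpath j
  have h2 := hside j
  unfold pathSide at h2
  rw [if_pos ⟨hw, halive, hpath⟩, ← hlo, ← hhi, not_le] at h2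
  rw [← hlo, ← hhi] at h1
  have h3 : L.hi j - L.lo j ≤ η := by
    by_contra h
    exact absurd (ENNReal.ofReal_le_ofReal (not_le.1 h).le) (not_le.2 h2)
  have h4 := hwp.lo_le s hs j
  have h5 := hwp.le_hi s hs j
  rw [abs_le]
  constructor <;> linarith

end Consistency

end

end RegularTreeSearch

/-! ### Consistency of the returned sample mean. -/

theorem theorem2 {d : ℕ} (hd : 0 < d)
    (p : RegularTreeSearch.Params) (hp : p.Valid) (N₀ : ℕ)
    -- the simulation model and its assumptions
    {Ξ : Type*} [MeasurableSpace Ξ] (M : RegularTreeSearch.Model d Ξ)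
    (σ : ℝ≥0) (hnoise : M.SubGaussianNoise σ)
    (xs : RegularTreeSearch.Point d) (hopt : M.IsUniqueOptimum xs)
    (hsmooth : M.LocallySmooth xs) (hsep : M.WellSeparated xs)
    -- the randomness
    {Ω : Type*} [MeasurableSpace Ω] (P : Measure Ω) [IsProbabilityMeasure P]
    (inp : Ω → RegularTreeSearch.Inputs d Ξ) (hinp : RegularTreeSearch.IsInputs M.ρ p.κ P inp)
    -- the splitting rule and the (possibly randomized) tree search strategy
    (rule : RegularTreeSearch.SplitRule d) (hrule : RegularTreeSearch.IsSplitRule p rule)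
    {V : Type*} (strat : RegularTreeSearch.Strategy d V) (hstrat : strat.SelectsLeaf)
    (seed : Ω → V)
    -- the depth conditions
    (hminus hplus : ℕ → ℕ)
    (hdepth : Tendsto (fun N => P {ω | ¬ ∀ L ∈
        RegularTreeSearch.finalLeaves p rule M strat N₀ (inp ω) (seed ω) N,
        hminus N ≤ L.depth ∧ L.depth ≤ hplus N}) atTop (𝓝 0))
    (hminus_top : Tendsto hminus atTop atTop)
    (hratio : Tendsto (fun N => (hplus N : ℝ) / p.f (hminus N)) atTop (𝓝 0))
    -- the returned leaf: a leaf with the largest sample mean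
    (Lstar : ℕ → Ω → RegularTreeSearch.Leaf d)
    (hLstar : ∀ N, N₀ < N → ∀ ω,
      Lstar N ω ∈ RegularTreeSearch.finalLeaves p rule M strat N₀ (inp ω) (seed ω) N ∧
      ∀ L ∈ RegularTreeSearch.finalLeaves p rule M strat N₀ (inp ω) (seed ω) N,
        L.sampleMean ≤ (Lstar N ω).sampleMean) :
    TendstoInMeasure P (fun N ω => (Lstar N ω).sampleMean) atTop (fun _ => M.μ xs) := by
  have := M.isProbabilityMeasure
  have hf := fun A hA => RegularTreeSearch.eventually_mul_le_threshold hp N₀ M P inp rule strat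
    hstrat seed hminus hplus hdepth hminus_top hratio (A := A) hA
  obtain ⟨C, hC, hlip⟩ := hsmooth
  have hd' : (0 : ℝ) < d := by exact_mod_cast hd
  rw [tendstoInMeasure_iff_norm]
  intro ε hε
  -- Sides of length at most `η` keep the samples within `d η` of the optimum, which costs at most
  -- `C d η = ε / 4` in `μ`.
  set η : ℝ := ε / (4 * C * d) with hη_def
  have hη : 0 < η := by positivity
  have hCη : C * (d * η) = ε / 4 := by rw [hη_def]; field_simp
  -- Enlarging the variance proxy makes it positive even if `σ = 0`, as the exponent in Hoeffding's
  -- bound requires.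
  have hc : (0 : ℝ≥0) < σ ^ 2 + 1 := by positivity
  have hsub : ∀ x ∈ RegularTreeSearch.cube d, HasSubgaussianMGF (M.noise x) (σ ^ 2 + 1) M.ρ :=
    fun x hx => RegularTreeSearch.HasSubgaussianMGF_mono (hnoise x hx).2 le_self_add
  -- The noise bound is indexed by the depth of the parent, hence the shift by one.
  have hnoisy := (RegularTreeSearch.tendsto_measure_noisy (N₀ := N₀) hinp hp hrule hc hsub
    (show 0 < ε / 4 by positivity) hf).comp ((tendsto_sub_atTop_nat 1).comp hminus_top)
  have hside := fun j => (RegularTreeSearch.tendsto_measure_pathSide (N₀ := N₀) hinp hp hrule xs j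
    hη).comp hminus_top
  have hcube : P {ω | ¬ ∀ i, ((inp ω).draw i).1 ∈ RegularTreeSearch.cube d} = 0 :=
    hinp.ae_cube
  have hlim := (hdepth.add hnoisy).add (tendsto_finsetSum Finset.univ fun j _ => hside j)
  simp only [add_zero, Finset.sum_const_zero] at hlim
  refine tendsto_of_tendsto_of_tendsto_of_le_of_le' tendsto_const_nhds hlim
    (Eventually.of_forall fun _ => zero_le) ?_
  filter_upwards [eventually_gt_atTop N₀, hminus_top.eventually (eventually_ge_atTop 1)]
    with N hN hN1
  refine (measure_mono (t := (({ω | ¬ ∀ L ∈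
      RegularTreeSearch.finalLeaves p rule M strat N₀ (inp ω) (seed ω) N,
        hminus N ≤ L.depth ∧ L.depth ≤ hplus N} ∪
      {ω | ∃ n, hminus N - 1 ≤ n ∧ ∃ a : List Bool, a.length = n + 1 ∧
        ∃ k, inp ω ∈ RegularTreeSearch.noisy p rule M N₀ (ε / 4) a k}) ∪
      ⋃ j ∈ (Finset.univ : Finset (Fin d)), {ω | ∃ c, hminus N ≤ c ∧ ∃ a : List Bool, a.length = c ∧
        ENNReal.ofReal η ≤ RegularTreeSearch.pathSide p rule M N₀ xs j (inp ω) a}) ∪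
      {ω | ¬ ∀ i, ((inp ω).draw i).1 ∈ RegularTreeSearch.cube d}) ?_).trans ?_
  · intro ω hω
    by_contra hgood
    simp only [Set.mem_union, Set.mem_iUnion, Set.mem_ofPred_eq, Finset.mem_univ, exists_prop,
      true_and, not_or, not_not, not_exists, not_and] at hgood
    obtain ⟨⟨⟨hgood_depth, hgood_noise⟩, hgood_side⟩, hgood_cube⟩ := hgood
    have hprop : ∀ L ∈ RegularTreeSearch.finalLeaves p rule M strat N₀ (inp ω) (seed ω) N,
        RegularTreeSearch.IsCurrent p rule M N₀ (inp ω) L ∧ L.WellPlaced ∧ 0 < L.dataI.length ∧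
          |RegularTreeSearch.deviation M L| < ε / 4 * L.dataI.length := by
      intro L hL
      have h1 := RegularTreeSearch.isCurrent_finalLeaves p rule M N₀ (inp ω) (seed ω) hstrat N hL
      have h2 := (hgood_depth L hL).1
      have h3 : L.addr.length = L.depth := rfl
      exact ⟨h1, h1.properties hp hgood_cube (hN1.trans h2) fun k =>
        hgood_noise (L.depth - 1) (by omega) L.addr (by omega) k⟩
    obtain ⟨hmem, hmax⟩ := hLstar N hN ω
    obtain ⟨-, hwp, hlen, hdev⟩ := hprop _ hmem
    have hupper : (Lstar N ω).sampleMean ≤ M.μ xs + ε / 4 :=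
      RegularTreeSearch.sampleMean_le hlen (fun s hs => hopt.2.1 _ (hwp.mem_cube hs)) hdev
    -- The leaf around the optimum is the competitor: its mean bounds the maximal one from below.
    obtain ⟨L, hL, hpath⟩ := RegularTreeSearch.exists_onPath_finalLeaves p rule M N₀ (inp ω)
      (seed ω) hstrat N xs
    obtain ⟨hcur, hwp', hlen', hdev'⟩ := hprop L hL
    have hlower : M.μ xs - ε / 4 - ε / 4 ≤ L.sampleMean := by
      refine RegularTreeSearch.le_sampleMean hlen' (fun s hs => ?_) hdev'
      have h1 := hcur.dist_le hgood_cube hwp' hopt.1 hpath hη.le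
        (fun j => hgood_side j L.depth (hgood_depth L hL).1 L.addr rfl) hs
      have h2 := hlip s.1 (hwp'.mem_cube hs)
      have h3 := mul_le_mul_of_nonneg_left h1 hC.le
      linarith
    have h4 := hmax L hL
    have h5 : ε ≤ ‖(Lstar N ω).sampleMean - M.μ xs‖ := hω
    rw [Real.norm_eq_abs, le_abs] at h5
    rcases h5 with h5 | h5 <;> linarith
  · refine (measure_union_le _ _).trans ?_
    rw [hcube, add_zero]
    exact (measure_union_le _ _).trans
      (add_le_add (measure_union_le _ _) (measure_biUnion_finset_le _ _))
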